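/- Let $k$ be a field, $V$ a finite-dimensional $k$-vector space with a totally ordered basis $X$, and $c$ an automorphism of $V\otimes V$ satisfying the braid equation $(c\otimes\mathrm{id})(\mathrm{id}\otimes c)(c\otimes\mathrm{id})=(\mathrm{id}\otimes c)(c\otimes\mathrm{id})(\mathrm{id}\otimes c)$ on $V^{\otimes 3}$. *Triangularity.* An endomorphism $r$ of $V\otimes V$ is left triangular with respect to $X$ if there are $\gamma_{x,y}\in k$ and $v_{x,y,z}\in V$ with $r(x\otimes y)=\gamma_{x,y}\,y\otimes x+\sum_{z\in X,\,z>y}z\otimes v_{x,y,z}$ for all $x,y\in X$; the map $d:x\otimes y\mapsto\gamma_{x,y}\,y\otimes x$ is then its diagonal component. Call $r$ admissible if it satisfies the braid equation and is left triangular (invertibility is not required). Assume that $c$ is left triangular with respect to $X$. *The tensor algebra.* For an endomorphism $r$ of $V\otimes V$ let $r_{n,m}:V^{\otimes n}\otimes V^{\otimes m}\to V^{\otimes m}\otimes V^{\otimes n}$ be given by $r_{0,m}=\mathrm{id}$, $r_{n,0}=\mathrm{id}$, $r_{1,1}=r$, $r_{1,m+1}=(\mathrm{id}_V\otimes r_{1,m})(r\otimes\mathrm{id})$,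 $r_{n+1,m}=(r_{n,m}\otimes\mathrm{id}_V)(\mathrm{id}\otimes r_{1,m})$. The maps $c_{n,m}$ form a braiding $c$ on $T(V)$. With the multiplication $(m\otimes m)(\mathrm{id}\otimes c\otimes\mathrm{id})$ on $T(V)\otimes T(V)$, where $m$ denotes the multiplication of $T(V)$, let $\Delta:T(V)\to T(V)\otimes T(V)$ and $\varepsilon:T(V)\to k$ be the algebra homomorphisms with $\Delta(v)=v\otimes1+1\otimes v$ and $\varepsilon(v)=0$ for $v\in V$. A braided biideal is a two-sided ideal $I$ of $T(V)$ with $\Delta(I)\subseteq T(V)\otimes I+I\otimes T(V)$, $\varepsilon(I)=0$ and $c(T(V)\otimes I+I\otimes T(V))=T(V)\otimes I+I\otimes T(V)$. Let $I\subsetneq T(V)$ be a braided biideal and $\pi:T(V)\to T(V)/I$ the quotient map. *Words.* Identify $T(V)$ with the free algebra $k\mathbb X$, where $\mathbb X$ is the set of words in the letters $X$, ordered lexicographically (a proper beginning of a word is smaller than the word). A nonempty word is Lyndon if it is smaller than all of its proper nonempty endings. Each word has a unique Lyndon decomposition $u_1\cdots u_t$ into Lyndon words $u_1\ge\dots\ge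 u_t$ ($u_1$ is the longest beginning that is Lyndon); the Shirshov decomposition of a Lyndon word $u$ of length at least $2$ is $u=vw$ with $w$ its longest proper ending that is Lyndon. For an endomorphism $r$ of $V\otimes V$ put $[1]_r=1$, $[x]_r=x$ for $x\in X$, $[u]_r=m(\mathrm{id}-r_{l(v),l(w)})([v]_r\otimes[w]_r)$ for $u$ Lyndon with Shirshov decomposition $u=vw$ (where $l$ is the length of a word), and $[u]_r=[u_1]_r\cdots[u_t]_r$ if $u$ has Lyndon decomposition $u_1\cdots u_t$. For a set $U$ of words let $[U]_r=\{[u]_r : u\in U\}$. *PBW data.* Write $u\succ v$ if $u$ is shorter than $v$, or $l(u)=l(v)$ and $u>v$; let $k\mathbb X_{\succ u}$ be the span of the words $\succ u$. Let $S_I$ be the set of Lyndon words $u$ with $u\notin k\mathbb X_{\succ u}+I$, put $h_I(u)=\min\{t\in\mathbb N : u^t\in k\mathbb X_{\succ u^t}+I\}$ for $u\in S_I$ ($\infty$ if there is no such $t$), and let $B_I$ be the set of words $s_1^{e_1}\cdots s_t^{e_t}$ with $t\ge0$, $s_1>\dots>s_t$ in $S_I$ and $0<e_i<h_I(s_i)$.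 In general, for pairwise distinct elements $a_s$ ($s\in S_I$) of an algebra $A$, we say that they generate a truncated PBW basis of $A$ with heights $h_I$ if the set of all products $a_{s_1}^{e_1}\cdots a_{s_t}^{e_t}$, with $t$, $s_i$, $e_i$ as before, is a basis of $A$. **Theorem.** 1. For every admissible $r$, the elements $[u]_r$ ($u\in B_I$) are linearly independent and span a complement of $I$ in $T(V)$. The elements $\pi([u]_r)$ ($u\in B_I$) form a basis of $T(V)/I$. This is the truncated PBW basis generated by the (pairwise distinct) elements $\pi([s]_r)$ ($s\in S_I$) with heights $h_I(s)$. 2. The diagonal component $d$ of $c$ is invertible, $d^{-1}$ is admissible, and $[B_I]_{d^{-1}}$ spans a complement of $I$. 3. In particular $\pi(B_I)$ and $\pi([B_I]_c)$ are bases of $T(V)/I$, namely the truncated PBW bases generated by $\pi(S_I)$ and by $\pi([S_I]_c)$, respectively, with heights $h_I(s)$ for $s\in S_I$. -/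

import Mathlib

open scoped TensorProduct

namespace BraidedPBW

noncomputable section

/-! ### Words, Lyndon words, orders

Words in the letters of a totally ordered type `ι` are lists. The order `<` on `List ι` is the
lexicographical order, in which a proper beginning of a word is smaller than the word. -/

section Words

variable {ι : Type*} [LinearOrder ι]

/-- A Lyndon word: a nonempty word that is smaller than each of its proper nonempty endings. -/
def IsLyndon (u : List ι) : Prop :=
  u ≠ [] ∧ ∀ v w : List ι, v ≠ [] → w ≠ [] → u = v ++ w → u < w

/-- The standard order: `StdGT u v` means that `u` is strictly larger than `v`, i.e. `u` is
shorter than `v`, or both have the same length and `u` is lexicographically larger. -/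
def StdGT (u v : List ι) : Prop :=
  u.length < v.length ∨ (u.length = v.length ∧ v < u)

/-- The power `u ^ t` of a word. -/
def wordPow (u : List ι) (t : ℕ) : List ι := (List.replicate t u).flatten

/-- The position at which the longest proper ending of `u` that is Lyndon starts; for a Lyndon
word `u` of length at least two this gives the Shirshov decomposition
`u = (u.take j) (u.drop j)`. -/
def shirshovIndex (u : List ι) : ℕ := sInf {j : ℕ | 0 < j ∧ IsLyndon (u.drop j)}

open Classical in
/-- The length of the longest beginning of `u` that is a Lyndon word, i.e. of the first factor in
the Lyndon decomposition of `u`. -/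
def lyndonPrefixLength (u : List ι) : ℕ :=
  Nat.findGreatest (fun j => IsLyndon (u.take j)) u.length

theorem isLyndon_singleton (x : ι) : IsLyndon [x] := by
  refine ⟨by simp, fun v w hv hw h => ?_⟩
  have := congrArg List.length h
  have h1 := List.length_pos_iff.2 hv
  have h2 := List.length_pos_iff.2 hw
  simp at this
  omega

theorem shirshovIndex_spec (u : List ι) (hu : 2 ≤ u.length) :
    0 < shirshovIndex u ∧ shirshovIndex u < u.length ∧ IsLyndon (u.drop (shirshovIndex u)) := by
  have hmem : u.length - 1 ∈ {j : ℕ | 0 < j ∧ IsLyndon (u.drop j)} := by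
    refine ⟨by omega, ?_⟩
    have hlen : (u.drop (u.length - 1)).length = 1 := by simp; omega
    obtain ⟨x, hx⟩ := List.length_eq_one_iff.1 hlen
    rw [hx]
    exact isLyndon_singleton x
  have h1 := Nat.sInf_mem ⟨_, hmem⟩
  have h2 : shirshovIndex u ≤ u.length - 1 := Nat.sInf_le hmem
  exact ⟨h1.1, by omega, h1.2⟩

theorem lyndonPrefixLength_spec (u : List ι) (hu : u ≠ []) :
    0 < lyndonPrefixLength u ∧ lyndonPrefixLength u ≤ u.length ∧
      IsLyndon (u.take (lyndonPrefixLength u)) := by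
  classical
  obtain ⟨x, w, rfl⟩ := List.exists_cons_of_ne_nil hu
  have h1 : IsLyndon ((x :: w).take 1) := by simpa using isLyndon_singleton x
  have hle : 1 ≤ (x :: w).length := by simp
  refine ⟨?_, ?_, ?_⟩
  · have := Nat.le_findGreatest (P := fun j => IsLyndon ((x :: w).take j)) hle h1
    unfold lyndonPrefixLength
    rw [← Nat.succ_le_iff]
    convert this
  · exact Nat.findGreatest_le _
  · have := Nat.findGreatest_spec (P := fun j => IsLyndon ((x :: w).take j)) hle h1
    unfold lyndonPrefixLength
    convert this

end Words

/-! ### PBW sets -/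

section PBW

/-- The set of all products `s_1 ^ e_1 * ... * s_t ^ e_t` with `t ≥ 0`, `s_1 > ... > s_t` and
`0 < e_i < h (s_i)`; the generators are indexed by an ordered type `σ`. -/
def pbwSet {A σ : Type*} [Monoid A] [LT σ] (s : σ → A) (h : σ → ℕ∞) : Set A :=
  {a | ∃ l : List (σ × ℕ), (l.map Prod.fst).Pairwise (fun x y => y < x) ∧
    (∀ p ∈ l, 0 < p.2 ∧ (p.2 : ℕ∞) < h p.1) ∧
    a = (l.map fun p => s p.1 ^ p.2).prod}

/-- The family `f`, indexed by the elements of `s`, is a basis. -/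
def IsBasisOn {α : Type*} (k : Type*) {M : Type*} [Field k] [AddCommGroup M] [Module k M]
    (f : α → M) (s : Set α) : Prop :=
  LinearIndepOn k f s ∧ Submodule.span k (f '' s) = ⊤

/-- The pairwise distinct elements `s x` (ordered by their indices), with heights `h x`, generate
a PBW basis of the algebra `A`. -/
def IsPBWBasis (k : Type*) {A σ : Type*} [Field k] [Ring A] [Algebra k A] [LT σ]
    (s : σ → A) (h : σ → ℕ∞) : Prop :=
  Function.Injective s ∧ IsBasisOn k (id : A → A) (pbwSet s h)

end PBW

/-! ### Braidings -/

section Braiding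

variable {k : Type*} [Field k] {V : Type*} [AddCommGroup V] [Module k V]

/-- The braid equation `(r ⊗ id)(id ⊗ r)(r ⊗ id) = (id ⊗ r)(r ⊗ id)(id ⊗ r)` on `V ⊗ V ⊗ V`. -/
def BraidEquation (r : V ⊗[k] V →ₗ[k] V ⊗[k] V) : Prop :=
  let r₁ : (V ⊗[k] V) ⊗[k] V →ₗ[k] (V ⊗[k] V) ⊗[k] V := r.rTensor V
  let r₂ : (V ⊗[k] V) ⊗[k] V →ₗ[k] (V ⊗[k] V) ⊗[k] V :=
    (TensorProduct.assoc k V V V).symm.toLinearMap ∘ₗ r.lTensor V ∘ₗ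
      (TensorProduct.assoc k V V V).toLinearMap
  r₁ ∘ₗ r₂ ∘ₗ r₁ = r₂ ∘ₗ r₁ ∘ₗ r₂

variable {ι : Type*} [LinearOrder ι] [Fintype ι]

/-- `r (x ⊗ y) = γ_{x,y} y ⊗ x + ∑_{z > y} z ⊗ v_{x,y,z}` for all `x`, `y` in the basis `X`, for
the given coefficients `γ` and some vectors `v_{x,y,z}`. -/
def IsLeftTriangularWith (X : Module.Basis ι k V) (r : V ⊗[k] V →ₗ[k] V ⊗[k] V)
    (γ : ι → ι → k) : Prop :=
  ∃ v : ι → ι → ι → V, ∀ x y : ι,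
    r (X x ⊗ₜ[k] X y) = γ x y • (X y ⊗ₜ[k] X x) + ∑ z with y < z, X z ⊗ₜ[k] v x y z

/-- Left triangular endomorphisms of `V ⊗ V` with respect to the ordered basis `X`. -/
def IsLeftTriangular (X : Module.Basis ι k V) (r : V ⊗[k] V →ₗ[k] V ⊗[k] V) : Prop :=
  ∃ γ : ι → ι → k, IsLeftTriangularWith X r γ

/-- `d` is the diagonal component `x ⊗ y ↦ γ_{x,y} y ⊗ x` of the left triangular `r`. -/
def IsDiagonalComponent (X : Module.Basis ι k V) (r d : V ⊗[k] V →ₗ[k] V ⊗[k] V) : Prop :=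
  ∃ γ : ι → ι → k, IsLeftTriangularWith X r γ ∧
    ∀ x y : ι, d (X x ⊗ₜ[k] X y) = γ x y • (X y ⊗ₜ[k] X x)

/-- Admissible endomorphisms (not necessarily invertible) of `V ⊗ V`. -/
def IsAdmissible (X : Module.Basis ι k V) (r : V ⊗[k] V →ₗ[k] V ⊗[k] V) : Prop :=
  BraidEquation r ∧ IsLeftTriangular X r

end Braiding

/-! ### The induced map on the tensor algebra -/

section Tensor

variable {k : Type*} [Field k] {V : Type*} [AddCommGroup V] [Module k V]

local notation "T" => TensorAlgebra k V

/-- `a ⊗ (b ⊗ v) ↦ a b ⊗ v`. -/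
def mulLetterLeft : V ⊗[k] (T ⊗[k] V) →ₗ[k] T ⊗[k] V :=
  (LinearMap.mul' k T ∘ₗ (TensorAlgebra.ι k).rTensor T).rTensor V ∘ₗ
    (TensorProduct.assoc k V T V).symm.toLinearMap

/-- `(a ⊗ b) ⊗ v ↦ a ⊗ b v`. -/
def mulLetterRight : (T ⊗[k] T) ⊗[k] V →ₗ[k] T ⊗[k] T :=
  (LinearMap.mul' k T ∘ₗ (TensorAlgebra.ι k).lTensor T).lTensor T ∘ₗ
    (TensorProduct.assoc k T T V).toLinearMap

/-- The step `c_{1,m} ↦ c_{1,m+1} = (id ⊗ c_{1,m})(c ⊗ id)`: from `f = c_{1,m} (- ⊗ w)` one gets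
`c_{1,m+1} (- ⊗ x w)`. -/
def letterStep (r : V ⊗[k] V →ₗ[k] V ⊗[k] V) : V →ₗ[k] Module.End k (V →ₗ[k] T ⊗[k] V) :=
  LinearMap.mk₂ k
    (fun x f => mulLetterLeft ∘ₗ f.lTensor V ∘ₗ r ∘ₗ (TensorProduct.mk k V V).flip x)
    (fun x y f => by simp [LinearMap.comp_add])
    (fun a x f => by simp [LinearMap.comp_smul])
    (fun x f g => by simp [LinearMap.comp_add, LinearMap.add_comp, LinearMap.lTensor_add])
    (fun a x f => by simp [LinearMap.comp_smul, LinearMap.smul_comp, LinearMap.lTensor_smul])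

/-- The maps `c_{1,m}`, `m ≥ 0`, together: `w ↦ (v ↦ c_{1,m} (v ⊗ w))`. -/
def braidLetter (r : V ⊗[k] V →ₗ[k] V ⊗[k] V) : T →ₗ[k] V →ₗ[k] T ⊗[k] V :=
  LinearMap.applyₗ (TensorProduct.mk k T V 1) ∘ₗ (TensorAlgebra.lift k (letterStep r)).toLinearMap

/-- The step `c_{n,m} ↦ c_{n+1,m} = (c_{n,m} ⊗ id)(id ⊗ c_{1,m})`: from `f = c_{n,m} (u ⊗ -)` one
gets `c_{n+1,m} (u x ⊗ -)`. -/
def wordStep (r : V ⊗[k] V →ₗ[k] V ⊗[k] V) : V →ₗ[k] Module.End k (T →ₗ[k] T ⊗[k] T) :=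
  LinearMap.mk₂ k
    (fun x f => mulLetterRight ∘ₗ f.rTensor V ∘ₗ (braidLetter r).flip x)
    (fun x y f => by simp [LinearMap.comp_add])
    (fun a x f => by simp [LinearMap.comp_smul])
    (fun x f g => by simp [LinearMap.comp_add, LinearMap.add_comp, LinearMap.rTensor_add])
    (fun a x f => by simp [LinearMap.comp_smul, LinearMap.smul_comp, LinearMap.rTensor_smul])

/-- The endomorphism of `T(V) ⊗ T(V)` that is `r_{n,m}` on `V^{⊗ n} ⊗ V^{⊗ m}`. For a braiding
`c` this is the induced braiding of the tensor algebra. The opposite algebra is used because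
`wordStep` adds letters at the right end of the word. -/
def tensorBraiding (r : V ⊗[k] V →ₗ[k] V ⊗[k] V) : T ⊗[k] T →ₗ[k] T ⊗[k] T :=
  TensorProduct.lift
    (LinearMap.applyₗ ((TensorProduct.mk k T T).flip 1) ∘ₗ
      (MulOpposite.opLinearEquiv k).symm.toLinearMap ∘ₗ
      (TensorAlgebra.lift k ((MulOpposite.opLinearEquiv k).toLinearMap ∘ₗ
        wordStep r)).toLinearMap)

/-- The multiplication `(m ⊗ m)(id ⊗ c ⊗ id)` of the braided tensor product of `T(V)` with
itself. -/
def braidedMul (r : V ⊗[k] V →ₗ[k] V ⊗[k] V) :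
    (T ⊗[k] T) ⊗[k] (T ⊗[k] T) →ₗ[k] T ⊗[k] T :=
  TensorProduct.map (LinearMap.mul' k T) (LinearMap.mul' k T) ∘ₗ
    (TensorProduct.assoc k T T (T ⊗[k] T)).symm.toLinearMap ∘ₗ
    ((TensorProduct.assoc k T T T).toLinearMap ∘ₗ (tensorBraiding r).rTensor T ∘ₗ
      (TensorProduct.assoc k T T T).symm.toLinearMap).lTensor T ∘ₗ
    (TensorProduct.assoc k T T (T ⊗[k] T)).toLinearMap

/-- The comultiplication of `T(V)`: it sends `1` to `1 ⊗ 1` and `v w`, for `v` in `V`, to the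
product of `v ⊗ 1 + 1 ⊗ v` and the comultiplication of `w` in the braided tensor product. -/
def comul (r : V ⊗[k] V →ₗ[k] V ⊗[k] V) : T →ₗ[k] T ⊗[k] T :=
  LinearMap.applyₗ ((1 : T) ⊗ₜ[k] (1 : T)) ∘ₗ
    (TensorAlgebra.lift k
      ((TensorProduct.curry (braidedMul r) : T ⊗[k] T →ₗ[k] Module.End k (T ⊗[k] T)) ∘ₗ
        (((TensorProduct.mk k T T).flip 1 + TensorProduct.mk k T T 1) ∘ₗ
          TensorAlgebra.ι k))).toLinearMap

/-- The subspace `T(V) ⊗ I + I ⊗ T(V)` of `T(V) ⊗ T(V)`. -/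
def tensorIdeal (I : Ideal T) : Submodule k (T ⊗[k] T) :=
  LinearMap.range ((I.restrictScalars k).subtype.lTensor T) ⊔
    LinearMap.range ((I.restrictScalars k).subtype.rTensor T)

/-- Braided biideals of the braided bialgebra `T(V)`: two-sided ideals that are coideals and compatible with
the braiding. The counit of `T(V)` is `TensorAlgebra.algebraMapInv`. -/
structure IsBraidedBiideal (c : V ⊗[k] V →ₗ[k] V ⊗[k] V) (I : Ideal T) [I.IsTwoSided] :
    Prop where
  comul_le : (I.restrictScalars k).map (comul c) ≤ tensorIdeal I
  counit_eq_zero : ∀ a ∈ I, TensorAlgebra.algebraMapInv a = 0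
  braiding_eq : (tensorIdeal I).map (tensorBraiding c) = tensorIdeal I

variable {ι : Type*} (X : Module.Basis ι k V)

/-- The monomial in `T(V)` belonging to a word in the basis `X`. -/
def monomial (w : List ι) : T := (w.map fun i => TensorAlgebra.ι k (X i)).prod

variable [LinearOrder ι]

open Classical in
/-- The iterated commutators `[u]_r`: `[1]_r = 1`, `[x]_r = x` for letters `x`,
`[u]_r = m (id - r_{l(v),l(w)}) ([v]_r ⊗ [w]_r)` for Lyndon words `u` of length at least two with
Shirshov decomposition `u = v w`, and `[u]_r = [u_1]_r [u_2 ... u_t]_r` for a word with Lyndon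
decomposition `u = u_1 u_2 ... u_t`, `t ≥ 2`. -/
def bracket (r : V ⊗[k] V →ₗ[k] V ⊗[k] V) (u : List ι) : T :=
  if _h2 : u.length < 2 then monomial X u
  else if _hu : IsLyndon u then
    let p := bracket r (u.take (shirshovIndex u)) ⊗ₜ[k] bracket r (u.drop (shirshovIndex u))
    LinearMap.mul' k T (p - tensorBraiding r p)
  else
    bracket r (u.take (lyndonPrefixLength u)) * bracket r (u.drop (lyndonPrefixLength u))
termination_by u.length
decreasing_by
  · have := shirshovIndex_spec u (by omega)
    simp; omega
  · have := shirshovIndex_spec u (by omega)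
    simp; omega
  · have h := lyndonPrefixLength_spec u (by rintro rfl; simp at _h2)
    have h3 : lyndonPrefixLength u ≠ u.length := fun h4 => _hu (by simpa [h4] using h.2.2)
    simp; omega
  · have h := lyndonPrefixLength_spec u (by rintro rfl; simp at _h2)
    simp; omega

/-- The span `k𝕏_{≻u}` of all words that are larger than `u` in the standard order. -/
def spanAbove (u : List ι) : Submodule k T :=
  Submodule.span k (monomial X '' {w | StdGT w u})

/-- The set `S_I` of hard Lyndon words. -/
def hardWords (I : Ideal T) : Set (List ι) :=
  {u | IsLyndon u ∧ monomial X u ∉ spanAbove X u ⊔ I.restrictScalars k}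

/-- The height `h_I(u)`, the least `t` with `u ^ t ∈ k𝕏_{≻u^t} + I`, or `∞`. -/
def height (I : Ideal T) (u : List ι) : ℕ∞ :=
  sInf ((fun t : ℕ => (t : ℕ∞)) ''
    {t : ℕ | monomial X (wordPow u t) ∈ spanAbove X (wordPow u t) ⊔ I.restrictScalars k})

/-- The set `B_I` of words: the PBW set, in the free monoid of words, generated by `S_I` with the
lexicographical order and the heights `h_I`. -/
def pbwWords (I : Ideal T) : Set (List ι) :=
  FreeMonoid.ofList ⁻¹'
    pbwSet (fun u : hardWords X I => FreeMonoid.ofList u.1) (fun u => height X I u.1)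

end Tensor

end

end BraidedPBW

open BraidedPBW

/-!
# PBW bases of quotients of the tensor algebra by braided biideals

Call a word *normal* if modulo `I` it is not a linear combination of words that are larger in the
standard order. As only finitely many words are larger than a given one, any family `b u` whose
leading word is `u` gives a basis of a complement of `I` when `u` runs through the normal words
(`isBasisOn_of_leading`). For left triangular `r` the commutators `[u]_r` form such a family
(`bracket_sub_monomial_mem`), and so do the words themselves. By definition, `[u]_r` is the product
of the commutators of the factors in the Lyndon decomposition of `u`. So everything reduces to the
claim that the normal words are exactly the words of `B_I`.

Normal words belong to `B_I` because factors of normal words are normal (`IsNormal.mem_pbwWords`).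
The converse, `isNormal_of_mem_pbwWords`, rests on the comultiplication `Δ` of `T(V)`, which is
multiplicative for the braided product on `T(V) ⊗ T(V)` (`comul_mul`); this follows from the two
hexagon identities for the induced braiding, which hold for every `r`. Since `c` is left triangular,
exchanging two words yields the exchanged words up to a nonzero coefficient, modulo terms with a
lexicographically larger first tensor factor (`tensorBraiding_monomial`). Let `d` be the diagonal
component of `c` and `[u] = [u]_{d⁻¹}`. For a Lyndon word `u = v w`, the coefficient in
`[u] = [v] [w] - d⁻¹ ([v] ⊗ [w])` is the one for which the terms `v ⊗ [w]` in `Δ ([v] [w])` and in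
`Δ ([w] [v])` cancel, so that `Δ [u]` is `u ⊗ 1 + 1 ⊗ [u]` modulo terms whose first factor is larger
than `u` already at a common position (`IsLyndon.comul_bracket`).

Suppose that a word of `B_I` of length `n` is not normal, `n` being minimal. Then there is a
relation `f = ∑ α_v [v]` in `I` with words `v` of `B_I` of length at most `n`, some of them of
length `n`. Let `s` be the smallest Lyndon factor of the words of length `n` in it, and `j` the
largest multiplicity with which it occurs. The word `s ^ j` is normal by the definition of the
height, so there is a linear form `φ` that vanishes on `I` and on the words above `s ^ j`, but not
on `s ^ j`. As `I` is a coideal, `(φ ⊗ id) (Δ f)` lies in `I`. But each word `v = v' s ^ j` of length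
`n` in the relation contributes to it a nonzero multiple of `v'`, modulo larger words
(`comul_bracket_mul_pow`), and the remaining words contribute only words shorter than these `v'`.
So the smallest such `v'`, a word of `B_I` of length less than `n`, is not normal, a contradiction.
-/

namespace BraidedPBW

/-! ### Words and Lyndon words -/

section Words

variable {ι : Type*}

theorem wordPow_succ (u : List ι) (t : ℕ) : wordPow u (t + 1) = u ++ wordPow u t := by
  simp [wordPow, List.replicate_succ]

theorem wordPow_add (u : List ι) (s t : ℕ) : wordPow u (s + t) = wordPow u s ++ wordPow u t := by
  rw [wordPow, List.replicate_add, List.flatten_append, wordPow, wordPow]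

theorem length_wordPow (u : List ι) (t : ℕ) : (wordPow u t).length = t * u.length := by
  simp [wordPow]

variable [LinearOrder ι]

/-- `Dominates a b`: the words `a` and `b` differ at some common position, and `a` has the larger
letter at the first such position. So `b < a` holds for a reason that persists when both words are
prolonged. -/
def Dominates (a b : List ι) : Prop :=
  ∃ (p : List ι) (x y : ι) (b' a' : List ι), x < y ∧ b = p ++ x :: b' ∧ a = p ++ y :: a'

theorem Dominates.append {a b : List ι} (h : Dominates a b) (c d : List ι) :
    Dominates (a ++ c) (b ++ d) := by
  obtain ⟨p, x, y, b', a', hxy, rfl, rfl⟩ := h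
  exact ⟨p, x, y, b' ++ d, a' ++ c, hxy, by simp, by simp⟩

theorem Dominates.append_left {a b : List ι} (h : Dominates a b) (c : List ι) :
    Dominates (c ++ a) (c ++ b) := by
  obtain ⟨p, x, y, b', a', hxy, rfl, rfl⟩ := h
  exact ⟨c ++ p, x, y, b', a', hxy, by simp, by simp⟩

theorem not_dominates_nil (a : List ι) : ¬ Dominates a [] := by
  rintro ⟨p, x, y, b', a', hxy, h, -⟩
  simp at h

theorem not_nil_dominates (a : List ι) : ¬ Dominates [] a := by
  rintro ⟨p, x, y, b', a', hxy, -, h⟩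
  simp at h

theorem cons_dominates_cons {x y : ι} {a b : List ι} :
    Dominates (x :: a) (y :: b) ↔ y < x ∨ (x = y ∧ Dominates a b) := by
  constructor
  · rintro ⟨p, u, v, b', a', huv, hb, ha⟩
    cases p with
    | nil => simp_all
    | cons z p =>
      simp only [List.cons_append, List.cons.injEq] at ha hb
      exact Or.inr ⟨ha.1.trans hb.1.symm, p, u, v, b', a', huv, hb.2, ha.2⟩
  · rintro (h | ⟨rfl, h⟩)
    · exact ⟨[], y, x, b, a, h, rfl, rfl⟩
    · exact h.append_left [x]

theorem lt_iff_dominates_or_append {a b : List ι} :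
    b < a ↔ Dominates a b ∨ ∃ c ≠ [], a = b ++ c := by
  induction b generalizing a with
  | nil =>
    cases a with
    | nil => simp [not_dominates_nil]
    | cons x a => simp
  | cons y b ih =>
    cases a with
    | nil => simp [not_nil_dominates]
    | cons x a =>
      rw [List.cons_lt_cons_iff, cons_dominates_cons, ih]
      constructor
      · rintro (h | ⟨rfl, h | ⟨c, hc, rfl⟩⟩)
        · exact Or.inl (Or.inl h)
        · exact Or.inl (Or.inr ⟨rfl, h⟩)
        · exact Or.inr ⟨c, hc, rfl⟩
      · rintro ((h | ⟨rfl, h⟩) | ⟨c, hc, h⟩)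
        · exact Or.inl h
        · exact Or.inr ⟨rfl, Or.inl h⟩
        · simp only [List.cons_append, List.cons.injEq] at h
          exact Or.inr ⟨h.1.symm, Or.inr ⟨c, hc, h.2⟩⟩

theorem Dominates.lt {a b : List ι} (h : Dominates a b) : b < a :=
  lt_iff_dominates_or_append.2 (Or.inl h)

theorem dominates_of_lt {a b : List ι} (h : b < a) (hl : a.length ≤ b.length) :
    Dominates a b := by
  rcases lt_iff_dominates_or_append.1 h with h | ⟨c, hc, rfl⟩
  · exact h
  · simp [hc] at hl

theorem lt_append_self (a : List ι) {b : List ι} (hb : b ≠ []) : a < a ++ b :=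
  lt_iff_dominates_or_append.2 (Or.inr ⟨b, hb, rfl⟩)

theorem append_lt_append_left_iff (c : List ι) {a b : List ι} : c ++ a < c ++ b ↔ a < b := by
  induction c with
  | nil => rfl
  | cons x c ih => simp [ih]

theorem Dominates.trans {a b c : List ι} (h : Dominates a b) (h' : Dominates b c) :
    Dominates a c := by
  induction c generalizing a b with
  | nil => exact absurd h' (not_dominates_nil b)
  | cons z c ih =>
    cases b with
    | nil => exact absurd h (not_dominates_nil a)
    | cons y b =>
      cases a with
      | nil => exact absurd h (not_nil_dominates _)
      | cons x a =>
        rw [cons_dominates_cons] at h h' ⊢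
        rcases h with h | ⟨rfl, h⟩
        · rcases h' with h' | ⟨rfl, h'⟩
          · exact Or.inl (h'.trans h)
          · exact Or.inl h
        · rcases h' with h' | ⟨rfl, h'⟩
          · exact Or.inl h'
          · exact Or.inr ⟨rfl, ih h h'⟩

/-- A word not longer than `b` that dominates a prolongation of `b` dominates `b`. -/
theorem Dominates.of_append {a b c : List ι} (h : Dominates a (b ++ c))
    (hl : a.length ≤ b.length) : Dominates a b := by
  induction b generalizing a with
  | nil =>
    have : a = [] := by simpa using hl
    subst this
    exact absurd h (not_nil_dominates _)
  | cons y b ih =>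
    cases a with
    | nil => exact absurd h (not_nil_dominates _)
    | cons x a =>
      rw [List.cons_append, cons_dominates_cons] at h
      rw [cons_dominates_cons]
      exact h.imp id fun h => ⟨h.1, ih h.2 (by simpa using hl)⟩

/-- `DominatesPow s a`: the word `a` dominates some power of `s`, i.e. the infinite word
`s s s ...`. -/
def DominatesPow (s a : List ι) : Prop := ∃ N, Dominates a (wordPow s N)

theorem DominatesPow.append {s a : List ι} (h : DominatesPow s a) (b : List ι) :
    DominatesPow s (a ++ b) := by
  obtain ⟨N, h⟩ := h
  exact ⟨N, by simpa using h.append b []⟩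

theorem DominatesPow.append_left {s a : List ι} (h : DominatesPow s a) :
    DominatesPow s (s ++ a) := by
  obtain ⟨N, h⟩ := h
  exact ⟨N + 1, by rw [wordPow_succ]; exact h.append_left s⟩

theorem Dominates.dominatesPow {s a b : List ι} (h : Dominates a b) (hb : DominatesPow s b) :
    DominatesPow s a := by
  obtain ⟨N, hb⟩ := hb
  exact ⟨N, h.trans hb⟩

/-- A word dominating the infinite word `s s s ...` dominates each power of `s` at least as long
as itself. -/
theorem DominatesPow.dominates_wordPow {s a : List ι} (h : DominatesPow s a) {j : ℕ}
    (hj : a.length ≤ (wordPow s j).length) : Dominates a (wordPow s j) := by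
  obtain ⟨N, h⟩ := h
  rcases le_total N j with hN | hN
  · obtain ⟨i, rfl⟩ := Nat.exists_eq_add_of_le hN
    rw [wordPow_add]
    simpa using h.append [] (wordPow s i)
  · obtain ⟨i, rfl⟩ := Nat.exists_eq_add_of_le hN
    rw [wordPow_add] at h
    exact h.of_append hj

theorem IsLyndon.length_pos {u : List ι} (h : IsLyndon u) : 0 < u.length :=
  List.length_pos_iff.2 h.1

/-- A proper nonempty ending of a Lyndon word dominates it. -/
theorem IsLyndon.dominates {v w : List ι} (h : IsLyndon (v ++ w)) (hv : v ≠ []) (hw : w ≠ []) :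
    Dominates w (v ++ w) :=
  dominates_of_lt (h.2 v w hv hw rfl) (by simp)

theorem IsLyndon.append {u v : List ι} (hu : IsLyndon u) (hv : IsLyndon v) (huv : u < v) :
    IsLyndon (u ++ v) := by
  have key : u ++ v < v := by
    rcases lt_iff_dominates_or_append.1 huv with h | ⟨c, hc, rfl⟩
    · simpa using (h.append [] v).lt
    · rw [append_lt_append_left_iff]
      exact hv.2 u c hu.1 hc rfl
  refine ⟨by simp [hu.1], fun a w ha hw h => ?_⟩
  rcases List.append_eq_append_iff.1 h with ⟨c, rfl, hc⟩ | ⟨c, hc, rfl⟩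
  · rcases eq_or_ne c [] with rfl | hc'
    · simp only [List.nil_append] at hc
      subst hc
      exact key
    · exact key.trans (hv.2 c w hc' hw hc)
  · rcases eq_or_ne c [] with rfl | hc'
    · simpa using key
    · rw [hc] at hu
      have := hu.dominates ha hc'
      rw [hc]
      exact (this.append v v).lt

/-- If all nonempty endings of `y` are larger than `s`, then `y` dominates `s s s ...`. -/
theorem dominatesPow_of_endings {s : List ι} (n : ℕ) {y : List ι} (hn : y.length ≤ n) (hy : y ≠ [])
    (hs : s ≠ []) (h : ∀ v w, w ≠ [] → y = v ++ w → s < w) : DominatesPow s y := by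
  induction n generalizing y with
  | zero => exact absurd (by simpa using hn) hy
  | succ n ih =>
    rcases lt_iff_dominates_or_append.1 (h [] y hy rfl) with hd | ⟨c, hc, rfl⟩
    · exact ⟨1, by simpa [wordPow] using hd⟩
    · have := List.length_pos_iff.2 hs
      refine (ih (by simp at hn; omega) hc fun v w hw e => ?_).append_left
      exact h (s ++ v) w hw (by simp [e])

theorem IsLyndon.dominatesPow {s l : List ι} (hl : IsLyndon l) (hs : s ≠ []) (h : s < l) :
    DominatesPow s l := by
  refine dominatesPow_of_endings l.length le_rfl hl.1 hs fun v w hw e => ?_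
  rcases eq_or_ne v [] with rfl | hv
  · rw [e] at h
    simpa using h
  · exact h.trans (hl.2 v w hv hw e)

/-- The list `ls` is a Lyndon decomposition (of the word `ls.flatten`): a weakly decreasing list of
Lyndon words. -/
def IsLyndonList (ls : List (List ι)) : Prop :=
  (∀ l ∈ ls, IsLyndon l) ∧ ls.Pairwise (fun a b => b ≤ a)

theorem IsLyndonList.of_cons {l : List ι} {ls : List (List ι)} (h : IsLyndonList (l :: ls)) :
    IsLyndonList ls :=
  ⟨fun m hm => h.1 m (by simp [hm]), (List.pairwise_cons.1 h.2).2⟩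

theorem exists_isLyndonList_cons (ls : List (List ι)) :
    ∀ l : List ι, IsLyndon l → IsLyndonList ls →
      ∃ ls' : List (List ι), IsLyndonList ls' ∧ ls'.flatten = l ++ ls.flatten := by
  induction ls with
  | nil => exact fun l hl _ => ⟨[l], ⟨by simpa using hl, by simp⟩, by simp⟩
  | cons m ls ih =>
    intro l hl h
    by_cases hlm : l < m
    · obtain ⟨ls', h', e⟩ := ih (l ++ m) (hl.append (h.1 m (by simp)) hlm) h.of_cons
      exact ⟨ls', h', by simp [e]⟩
    · refine ⟨l :: m :: ls, ⟨?_, ?_⟩, by simp⟩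
      · intro a ha
        rcases List.mem_cons.1 ha with rfl | ha
        · exact hl
        · exact h.1 a ha
      · refine List.pairwise_cons.2 ⟨fun a ha => ?_, h.2⟩
        rcases List.mem_cons.1 ha with rfl | ha
        · exact not_lt.1 hlm
        · exact ((List.pairwise_cons.1 h.2).1 a ha).trans (not_lt.1 hlm)

theorem exists_isLyndonList (u : List ι) : ∃ ls, IsLyndonList ls ∧ ls.flatten = u := by
  induction u with
  | nil => exact ⟨[], ⟨by simp, by simp⟩, rfl⟩
  | cons x u ih =>
    obtain ⟨ls, h, rfl⟩ := ih
    exact exists_isLyndonList_cons ls [x] (isLyndon_singleton x) h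

/-- A Lyndon word that begins a product of weakly decreasing Lyndon words begins its first
factor. -/
theorem IsLyndonList.prefix_length_le {l : List ι} {ls : List (List ι)}
    (h : IsLyndonList (l :: ls)) {p q : List ι} (hp : IsLyndon p)
    (e : (l :: ls).flatten = p ++ q) : p.length ≤ l.length := by
  -- Otherwise `p = l ... q'` with `q'` a nonempty beginning of a later factor `m`, and
  -- `p < q' ≤ m ≤ l ≤ p`.
  by_contra! hlt
  obtain ⟨p', rfl⟩ : ∃ p', p = l ++ p' := by
    rcases List.append_eq_append_iff.1 (show l ++ ls.flatten = p ++ q from e) with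
      ⟨c, hc, -⟩ | ⟨c, hc, -⟩
    · exact ⟨c, hc⟩
    · rw [hc] at hlt
      simp at hlt
  have hp' : p' ≠ [] := by
    rintro rfl
    simp at hlt
  have e' : ls.flatten = p' ++ q := by simpa using e
  have key : ∀ (ms : List (List ι)), (∀ m ∈ ms, m ≤ l) → (∀ m ∈ ms, m ≠ []) →
      ∀ p' : List ι, p' ≠ [] → (∃ q, ms.flatten = p' ++ q) →
      ∃ a b, b ≠ [] ∧ p' = a ++ b ∧ b ≤ l := by
    intro ms
    induction ms with
    | nil =>
      rintro - - p' hp' ⟨q, hq⟩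
      simp at hq
      exact absurd hq.1 hp'
    | cons m ms ih =>
      rintro h1 h2 p' hp' ⟨q, hq⟩
      rcases List.append_eq_append_iff.1 (show m ++ ms.flatten = p' ++ q from hq) with
        ⟨c, rfl, hc⟩ | ⟨c, hc, -⟩
      · rcases eq_or_ne c [] with rfl | hc'
        · exact ⟨[], m, h2 m (by simp), by simp, h1 m (by simp)⟩
        · obtain ⟨a, b, hb, rfl, hbl⟩ := ih (fun k hk => h1 k (by simp [hk]))
            (fun k hk => h2 k (by simp [hk])) c hc' ⟨q, hc⟩
          exact ⟨m ++ a, b, hb, by simp, hbl⟩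
      · refine ⟨[], p', hp', rfl, le_trans ?_ (h1 m (by simp))⟩
        rcases eq_or_ne c [] with rfl | hc'
        · simp [hc]
        · rw [hc]
          exact (lt_append_self p' hc').le
  obtain ⟨a, b, hb, rfl, hbl⟩ := key ls (fun m hm => (List.pairwise_cons.1 h.2).1 m hm)
    (fun m hm => (h.1 m (by simp [hm])).1) p' hp' ⟨q, e'⟩
  have h1 : l ++ (a ++ b) < b := hp.2 (l ++ a) b (by simp [(h.1 l (by simp)).1]) hb (by simp)
  exact absurd (h1.trans_le hbl) (lt_append_self l (by simp [hb])).le.not_gt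

theorem IsLyndonList.lyndonPrefixLength_eq {l : List ι} {ls : List (List ι)}
    (h : IsLyndonList (l :: ls)) : lyndonPrefixLength (l :: ls).flatten = l.length := by
  have hl := h.1 l (by simp)
  have hne : (l :: ls).flatten ≠ [] := by simp [hl.1]
  have hspec := lyndonPrefixLength_spec _ hne
  refine le_antisymm ?_ ?_
  · have := h.prefix_length_le hspec.2.2 (List.take_append_drop _ _).symm
    rw [List.length_take] at this
    omega
  · classical
    unfold lyndonPrefixLength
    refine Nat.le_findGreatest (by simp) ?_
    simpa using hl

/-- The first factor of the Shirshov decomposition of a Lyndon word is a Lyndon word. -/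
theorem IsLyndon.take_shirshovIndex {u : List ι} (hu : IsLyndon u) (h2 : 2 ≤ u.length) :
    IsLyndon (u.take (shirshovIndex u)) := by
  -- With `l` the last factor in the Lyndon decomposition of `v` and `u = v w`, the product `l w`
  -- is a Lyndon ending of `u`, longer than `w`.
  obtain ⟨h0, hlt, hw⟩ := shirshovIndex_spec u h2
  obtain ⟨ls, hls, e⟩ := exists_isLyndonList (u.take (shirshovIndex u))
  set w := u.drop (shirshovIndex u) with hw'
  have huv : ls.flatten ++ w = u := by rw [e, List.take_append_drop]
  have hlen : ls.flatten.length = shirshovIndex u := by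
    rw [e, List.length_take]
    omega
  rcases List.eq_nil_or_concat ls with rfl | ⟨ms, l, rfl⟩
  · simp at hlen
    omega
  rcases ms with _ | ⟨m, ms⟩
  · rw [← e]
    simpa using hls.1 l (by simp)
  exfalso
  simp only [List.concat_eq_append] at hls huv hlen e
  have hl := hls.1 l (by simp)
  have hm := hls.1 m (by simp)
  have hlm : l ≤ m := (List.pairwise_cons.1 hls.2).1 l (by simp)
  have hmu : m < u := by
    rw [← huv]
    simpa using lt_append_self m (b := (ms ++ [l]).flatten ++ w) (by simp [hw.1])
  have huw : u < w := hu.2 (u.take (shirshovIndex u)) w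
    (by rw [← e]; simp [hm.1]) hw.1 (List.take_append_drop _ _).symm
  have hlw := hl.append hw (hlm.trans_lt (hmu.trans huw))
  have hdrop : u.drop ((m :: ms).flatten).length = l ++ w := by
    have : u = (m :: ms).flatten ++ (l ++ w) := by rw [← huv]; simp
    rw [this, List.drop_left]
  have hle : shirshovIndex u ≤ ((m :: ms).flatten).length := by
    refine Nat.sInf_le ⟨?_, by rw [hdrop]; exact hlw⟩
    have := hm.length_pos
    simp
    omega
  have := hl.length_pos
  simp at hle hlen
  omega

end Words

/-! ### The induced braiding and the multiplicativity of the comultiplication -/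

section BraidingAlgebra

variable {k : Type*} [Field k] {V : Type*} [AddCommGroup V] [Module k V]

local notation "T" => TensorAlgebra k V

variable (r : V ⊗[k] V →ₗ[k] V ⊗[k] V)

theorem mulLetterRight_tmul (z : T ⊗[k] T) (v : V) :
    mulLetterRight (z ⊗ₜ[k] v) = z * ((1 : T) ⊗ₜ[k] TensorAlgebra.ι k v) := by
  induction z with
  | zero => simp
  | add x y hx hy => rw [TensorProduct.add_tmul, map_add, hx, hy, add_mul]
  | tmul a b => simp [mulLetterRight]

theorem mulLetterLeft_tmul (v : V) (z : T ⊗[k] V) :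
    (TensorAlgebra.ι k).lTensor T (mulLetterLeft (v ⊗ₜ[k] z)) =
      (TensorAlgebra.ι k v ⊗ₜ[k] (1 : T)) * (TensorAlgebra.ι k).lTensor T z := by
  induction z with
  | zero => simp
  | add x y hx hy => simp only [TensorProduct.tmul_add, map_add, hx, hy, mul_add]
  | tmul a b => simp [mulLetterLeft]

theorem braidLetter_one (x : V) : braidLetter r 1 x = (1 : T) ⊗ₜ[k] x := by
  simp [braidLetter]

theorem braidLetter_ι_mul (x y : V) (w : T) :
    braidLetter r (TensorAlgebra.ι k y * w) x =
      mulLetterLeft ((braidLetter r w).lTensor V (r (x ⊗ₜ[k] y))) := by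
  simp [braidLetter, letterStep]

theorem tensorBraiding_one_left (w : T) :
    tensorBraiding r ((1 : T) ⊗ₜ[k] w) = w ⊗ₜ[k] (1 : T) := by
  simp [tensorBraiding]

theorem tensorBraiding_algebraMap_left (c : k) (w : T) :
    tensorBraiding r (algebraMap k T c ⊗ₜ[k] w) = c • (w ⊗ₜ[k] (1 : T)) := by
  rw [Algebra.algebraMap_eq_smul_one, ← TensorProduct.smul_tmul', map_smul,
    tensorBraiding_one_left]

/-- `p ⊗ q ↦ c (a ⊗ p) (1 ⊗ q)`. -/
noncomputable def braidRight (a : T) : T ⊗[k] T →ₗ[k] T ⊗[k] T :=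
  TensorProduct.lift (LinearMap.mk₂ k
    (fun p q => tensorBraiding r (a ⊗ₜ[k] p) * ((1 : T) ⊗ₜ[k] q))
    (fun x y f => by simp [TensorProduct.tmul_add, add_mul])
    (fun c x f => by simp)
    (fun x f g => by simp [TensorProduct.tmul_add, mul_add])
    (fun c x f => by simp))

/-- `p ⊗ q ↦ (p ⊗ 1) c (q ⊗ w)`. -/
noncomputable def braidLeft (w : T) : T ⊗[k] T →ₗ[k] T ⊗[k] T :=
  TensorProduct.lift (LinearMap.mk₂ k
    (fun p q => (p ⊗ₜ[k] (1 : T)) * tensorBraiding r (q ⊗ₜ[k] w))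
    (fun x y f => by simp [TensorProduct.add_tmul, add_mul])
    (fun c x f => by simp [← TensorProduct.smul_tmul'])
    (fun x f g => by simp [TensorProduct.add_tmul, mul_add])
    (fun c x f => by simp [← TensorProduct.smul_tmul']))

theorem braidRight_tmul (a p q : T) :
    braidRight r a (p ⊗ₜ[k] q) = tensorBraiding r (a ⊗ₜ[k] p) * ((1 : T) ⊗ₜ[k] q) := by
  simp [braidRight]

theorem braidLeft_tmul (w p q : T) :
    braidLeft r w (p ⊗ₜ[k] q) = (p ⊗ₜ[k] (1 : T)) * tensorBraiding r (q ⊗ₜ[k] w) := by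
  simp [braidLeft]

theorem braidRight_one (z : T ⊗[k] T) : braidRight r 1 z = z := by
  induction z with
  | zero => simp
  | add x y hx hy => rw [map_add, hx, hy]
  | tmul a b => simp [braidRight_tmul, tensorBraiding_one_left]

theorem braidRight_mul (a q : T) (z : T ⊗[k] T) :
    braidRight r a (z * ((1 : T) ⊗ₜ[k] q)) = braidRight r a z * ((1 : T) ⊗ₜ[k] q) := by
  induction z with
  | zero => simp
  | add x y hx hy => rw [add_mul, map_add, hx, hy, map_add, add_mul]
  | tmul a b => simp [braidRight_tmul, mul_assoc]

theorem braidLeft_mul (w p : T) (z : T ⊗[k] T) :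
    braidLeft r w ((p ⊗ₜ[k] (1 : T)) * z) = (p ⊗ₜ[k] (1 : T)) * braidLeft r w z := by
  induction z with
  | zero => simp
  | add x y hx hy => rw [mul_add, map_add, hx, hy, map_add, mul_add]
  | tmul a b => simp [braidLeft_tmul, ← mul_assoc]

theorem tensorBraiding_mul_ι (a w : T) (x : V) :
    tensorBraiding r ((a * TensorAlgebra.ι k x) ⊗ₜ[k] w) =
      braidRight r a ((TensorAlgebra.ι k).lTensor T (braidLetter r w x)) := by
  have h : tensorBraiding r ((a * TensorAlgebra.ι k x) ⊗ₜ[k] w) =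
      mulLetterRight (((TensorProduct.curry (tensorBraiding r)) a).rTensor V
        (braidLetter r w x)) := by
    simp only [tensorBraiding, TensorProduct.lift.tmul, LinearMap.comp_apply, map_mul,
      AlgHom.toLinearMap_apply, TensorAlgebra.lift_ι_apply, LinearEquiv.coe_coe,
      MulOpposite.coe_opLinearEquiv_symm, MulOpposite.unop_mul, MulOpposite.coe_opLinearEquiv,
      MulOpposite.unop_op]
    rfl
  rw [h]
  induction braidLetter r w x with
  | zero => simp
  | add x y hx hy => simp only [map_add, hx, hy]
  | tmul p v => simp [mulLetterRight_tmul, braidRight_tmul]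

theorem tensorBraiding_ι_left (w : T) (x : V) :
    tensorBraiding r (TensorAlgebra.ι k x ⊗ₜ[k] w) =
      (TensorAlgebra.ι k).lTensor T (braidLetter r w x) := by
  have := tensorBraiding_mul_ι r 1 w x
  rwa [one_mul, braidRight_one] at this

theorem tensorBraiding_ι_ι_mul (x y : V) (w : T) :
    tensorBraiding r (TensorAlgebra.ι k x ⊗ₜ[k] (TensorAlgebra.ι k y * w)) =
      braidLeft r w (TensorProduct.map (TensorAlgebra.ι k) (TensorAlgebra.ι k)
        (r (x ⊗ₜ[k] y))) := by
  rw [tensorBraiding_ι_left, braidLetter_ι_mul]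
  induction r (x ⊗ₜ[k] y) with
  | zero => simp
  | add x y hx hy => simp only [map_add, hx, hy]
  | tmul p v => simp [mulLetterLeft_tmul, braidLeft_tmul, tensorBraiding_ι_left]

/-- The first hexagon: a product in the first argument of the induced braiding. -/
theorem tensorBraiding_mul_left (b : T) : ∀ a w : T,
    tensorBraiding r ((a * b) ⊗ₜ[k] w) = braidRight r a (tensorBraiding r (b ⊗ₜ[k] w)) := by
  induction b using TensorAlgebra.induction with
  | algebraMap c =>
    intro a w
    rw [← Algebra.commutes, ← Algebra.smul_def, tensorBraiding_algebraMap_left, map_smul,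
      ← TensorProduct.smul_tmul', map_smul, braidRight_tmul]
    congr 1
    exact (mul_one _).symm
  | ι x => intro a w; rw [tensorBraiding_mul_ι, tensorBraiding_ι_left]
  | add b b' hb hb' =>
    intro a w
    rw [mul_add, TensorProduct.add_tmul, map_add, hb, hb', TensorProduct.add_tmul, map_add, map_add]
  | mul b b' hb hb' =>
    intro a w
    rw [← mul_assoc, hb', hb']
    induction tensorBraiding r (b' ⊗ₜ[k] w) with
    | zero => simp
    | add x y hx hy => simp only [map_add, hx, hy]
    | tmul p q => rw [braidRight_tmul, hb, braidRight_tmul, braidRight_mul]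

theorem tensorBraiding_ι_mul_right (w : T) : ∀ (x : V) (w' : T),
    tensorBraiding r (TensorAlgebra.ι k x ⊗ₜ[k] (w * w')) =
      braidLeft r w' (tensorBraiding r (TensorAlgebra.ι k x ⊗ₜ[k] w)) := by
  induction w using TensorAlgebra.induction with
  | algebraMap c =>
    intro x w'
    rw [← Algebra.smul_def, Algebra.algebraMap_eq_smul_one, TensorProduct.tmul_smul, map_smul,
      TensorProduct.tmul_smul, map_smul, map_smul]
    congr 1
    rw [tensorBraiding_ι_left r 1, braidLetter_one, LinearMap.lTensor_tmul, braidLeft_tmul]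
    exact (one_mul _).symm
  | ι y =>
    intro x w'
    have := tensorBraiding_ι_ι_mul r x y 1
    rw [mul_one] at this
    rw [tensorBraiding_ι_ι_mul, this]
    congr 1
    induction r (x ⊗ₜ[k] y) with
    | zero => simp
    | add x y hx hy => simp only [map_add, ← hx, ← hy]
    | tmul p q => simp [braidLeft_tmul, tensorBraiding_ι_left, braidLetter_one]
  | add w₁ w₂ h₁ h₂ =>
    intro x w'
    rw [add_mul, TensorProduct.tmul_add, map_add, h₁, h₂, TensorProduct.tmul_add, map_add, map_add]
  | mul w₁ w₂ h₁ h₂ =>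
    intro x w'
    rw [mul_assoc, h₁, h₁, tensorBraiding_ι_left]
    induction braidLetter r w₁ x with
    | zero => simp
    | add x y hx hy => simp only [map_add, hx, hy]
    | tmul p q =>
      rw [LinearMap.lTensor_tmul, braidLeft_tmul, braidLeft_tmul, h₂, braidLeft_mul]

/-- The second hexagon: a product in the second argument of the induced braiding. -/
theorem tensorBraiding_mul_right (a : T) : ∀ w w' : T,
    tensorBraiding r (a ⊗ₜ[k] (w * w')) = braidLeft r w' (tensorBraiding r (a ⊗ₜ[k] w)) := by
  induction a using TensorAlgebra.induction with
  | algebraMap c =>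
    intro w w'
    rw [tensorBraiding_algebraMap_left, tensorBraiding_algebraMap_left, map_smul, braidLeft_tmul,
      tensorBraiding_one_left]
    simp
  | ι x => exact fun w => tensorBraiding_ι_mul_right r w x
  | add a₁ a₂ h₁ h₂ =>
    intro w w'
    rw [TensorProduct.add_tmul, map_add, h₁, h₂, TensorProduct.add_tmul, map_add, map_add]
  | mul a₁ a₂ h₁ h₂ =>
    intro w w'
    rw [tensorBraiding_mul_left, tensorBraiding_mul_left, h₂]
    induction tensorBraiding r (a₂ ⊗ₜ[k] w) with
    | zero => simp
    | add x y hx hy => simp only [map_add, hx, hy]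
    | tmul p q =>
      obtain ⟨S, hS⟩ := TensorProduct.exists_finset (tensorBraiding r (a₁ ⊗ₜ[k] p))
      have key : ∀ z : T ⊗[k] T, braidRight r a₁ ((p ⊗ₜ[k] (1 : T)) * z) =
          ∑ i ∈ S, (i.1 ⊗ₜ[k] (1 : T)) * braidRight r i.2 z := by
        intro z
        induction z with
        | zero => simp
        | add x y hx hy => simp only [mul_add, map_add, hx, hy, Finset.sum_add_distrib]
        | tmul p' q' =>
          simp only [Algebra.TensorProduct.tmul_mul_tmul, one_mul, braidRight_tmul, h₁, hS, map_sum,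
            braidLeft_tmul, Finset.sum_mul, mul_assoc]
      rw [braidLeft_tmul, key, braidRight_tmul, hS, Finset.sum_mul, map_sum]
      refine Finset.sum_congr rfl fun i _ => ?_
      rw [Algebra.TensorProduct.tmul_mul_tmul, mul_one, braidLeft_tmul, tensorBraiding_mul_left]

theorem braidedMul_tmul (a b a' b' : T) :
    braidedMul r ((a ⊗ₜ[k] b) ⊗ₜ[k] (a' ⊗ₜ[k] b')) =
      (a ⊗ₜ[k] (1 : T)) * tensorBraiding r (b ⊗ₜ[k] a') * ((1 : T) ⊗ₜ[k] b') := by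
  simp only [braidedMul, LinearMap.comp_apply, LinearEquiv.coe_coe, TensorProduct.assoc_tmul,
    LinearMap.lTensor_tmul, TensorProduct.assoc_symm_tmul, LinearMap.rTensor_tmul]
  induction tensorBraiding r (b ⊗ₜ[k] a') with
  | zero => simp
  | add x y hx hy =>
    simp only [mul_add, add_mul, ← hx, ← hy, map_add, TensorProduct.add_tmul,
      TensorProduct.tmul_add]
  | tmul p q => simp

theorem one_braidedMul (z : T ⊗[k] T) :
    braidedMul r (((1 : T) ⊗ₜ[k] (1 : T)) ⊗ₜ[k] z) = z := by
  induction z with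
  | zero => simp
  | add x y hx hy => rw [TensorProduct.tmul_add, map_add, hx, hy]
  | tmul a b => simp [braidedMul_tmul, tensorBraiding_one_left]

theorem braidedMul_assoc (x y z : T ⊗[k] T) :
    braidedMul r (braidedMul r (x ⊗ₜ[k] y) ⊗ₜ[k] z) =
      braidedMul r (x ⊗ₜ[k] braidedMul r (y ⊗ₜ[k] z)) := by
  induction x with
  | zero => simp
  | add x y hx hy => simp only [TensorProduct.add_tmul, map_add, hx, hy]
  | tmul a b =>
  induction y with
  | zero => simp
  | add x y hx hy => simp only [TensorProduct.add_tmul, TensorProduct.tmul_add, map_add, hx, hy]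
  | tmul a' b' =>
  induction z with
  | zero => simp
  | add x y hx hy => simp only [TensorProduct.tmul_add, map_add, hx, hy]
  | tmul a'' b'' =>
    obtain ⟨S, hS⟩ := TensorProduct.exists_finset (tensorBraiding r (b ⊗ₜ[k] a'))
    have key : ∀ z : T ⊗[k] T,
        braidedMul r ((a ⊗ₜ[k] b) ⊗ₜ[k] ((a' ⊗ₜ[k] (1 : T)) * z * ((1 : T) ⊗ₜ[k] b''))) =
          ∑ i ∈ S, ((a * i.1) ⊗ₜ[k] (1 : T)) * braidRight r i.2 z * ((1 : T) ⊗ₜ[k] b'') := by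
      intro z
      induction z with
      | zero => simp
      | add x y hx hy =>
        simp only [mul_add, add_mul, TensorProduct.tmul_add, map_add, hx, hy,
          Finset.sum_add_distrib]
      | tmul p' q' =>
        simp only [Algebra.TensorProduct.tmul_mul_tmul, one_mul, mul_one, braidedMul_tmul,
          tensorBraiding_mul_right, hS, map_sum, Finset.mul_sum, Finset.sum_mul, braidLeft_tmul,
          braidRight_tmul]
        refine Finset.sum_congr rfl fun i _ => ?_
        simp only [mul_assoc, ← mul_assoc (a ⊗ₜ[k] (1 : T)), Algebra.TensorProduct.tmul_mul_tmul,
          mul_one]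
    rw [braidedMul_tmul r a' b', key, braidedMul_tmul, hS, Finset.mul_sum, Finset.sum_mul,
      TensorProduct.sum_tmul, map_sum]
    refine Finset.sum_congr rfl fun i _ => ?_
    rw [Algebra.TensorProduct.tmul_mul_tmul, Algebra.TensorProduct.tmul_mul_tmul, one_mul, mul_one,
      braidedMul_tmul, tensorBraiding_mul_left]

theorem comul_one : comul r (1 : T) = (1 : T) ⊗ₜ[k] (1 : T) := by
  simp [comul]

theorem comul_ι_mul (x : V) (a : T) :
    comul r (TensorAlgebra.ι k x * a) =
      braidedMul r ((TensorAlgebra.ι k x ⊗ₜ[k] (1 : T) + (1 : T) ⊗ₜ[k] TensorAlgebra.ι k x) ⊗ₜ[k]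
        comul r a) := by
  simp [comul, TensorProduct.add_tmul]

theorem comul_ι (x : V) :
    comul r (TensorAlgebra.ι k x) =
      TensorAlgebra.ι k x ⊗ₜ[k] (1 : T) + (1 : T) ⊗ₜ[k] TensorAlgebra.ι k x := by
  have := comul_ι_mul r x 1
  rw [mul_one, comul_one, TensorProduct.add_tmul, map_add, braidedMul_tmul, braidedMul_tmul,
    tensorBraiding_one_left] at this
  rw [this]
  have h := tensorBraiding_ι_left r 1 x
  rw [braidLetter_one] at h
  simp [h]

/-- The comultiplication is multiplicative for the braided product on `T(V) ⊗ T(V)`. -/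
theorem comul_mul (a : T) : ∀ b : T,
    comul r (a * b) = braidedMul r (comul r a ⊗ₜ[k] comul r b) := by
  induction a using TensorAlgebra.induction with
  | algebraMap c =>
    intro b
    rw [← Algebra.smul_def, Algebra.algebraMap_eq_smul_one, map_smul, map_smul, comul_one,
      ← TensorProduct.smul_tmul', map_smul, one_braidedMul]
  | ι x => intro b; rw [comul_ι_mul, comul_ι]
  | add a₁ a₂ h₁ h₂ =>
    intro b
    rw [add_mul, map_add, h₁, h₂, map_add, TensorProduct.add_tmul, map_add]
  | mul a₁ a₂ h₁ h₂ =>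
    intro b
    rw [mul_assoc, h₁, h₂, h₁, braidedMul_assoc]

end BraidingAlgebra

/-! ### Triangularity of the induced braiding and of the iterated commutators -/

section Triangular

variable {k : Type*} [Field k] {V : Type*} [AddCommGroup V] [Module k V]

local notation "T" => TensorAlgebra k V

variable {ι : Type*} (X : Module.Basis ι k V)

theorem monomial_nil : monomial X [] = 1 := by simp [monomial]

theorem monomial_singleton (x : ι) : monomial X [x] = TensorAlgebra.ι k (X x) := by
  simp [monomial]

theorem monomial_append (a b : List ι) : monomial X (a ++ b) = monomial X a * monomial X b := by
  simp [monomial]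

theorem monomial_cons (x : ι) (b : List ι) :
    monomial X (x :: b) = TensorAlgebra.ι k (X x) * monomial X b := by
  simp [monomial]

/-- The span of the words with the property `P`. -/
def wordSpan (P : List ι → Prop) : Submodule k T :=
  Submodule.span k (monomial X '' {w | P w})

/-- The span in `T(V) ⊗ T(V)` of the pairs of words with the property `P`. -/
def tensorSpan (P : List ι → List ι → Prop) : Submodule k (T ⊗[k] T) :=
  Submodule.span k
    ((fun p : List ι × List ι => monomial X p.1 ⊗ₜ[k] monomial X p.2) '' {p | P p.1 p.2})

variable {X}

theorem monomial_mem_wordSpan {P : List ι → Prop} {w : List ι} (h : P w) :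
    monomial X w ∈ wordSpan X P :=
  Submodule.subset_span ⟨w, h, rfl⟩

theorem tmul_mem_tensorSpan {P : List ι → List ι → Prop} {a b : List ι} (h : P a b) :
    monomial X a ⊗ₜ[k] monomial X b ∈ tensorSpan X P :=
  Submodule.subset_span ⟨(a, b), h, rfl⟩

theorem wordSpan_le {P : List ι → Prop} {N : Submodule k T}
    (h : ∀ w, P w → monomial X w ∈ N) : wordSpan X P ≤ N := by
  refine Submodule.span_le.2 ?_
  rintro _ ⟨w, hw, rfl⟩
  exact h w hw

theorem tensorSpan_le {P : List ι → List ι → Prop} {N : Submodule k (T ⊗[k] T)}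
    (h : ∀ a b, P a b → monomial X a ⊗ₜ[k] monomial X b ∈ N) : tensorSpan X P ≤ N := by
  refine Submodule.span_le.2 ?_
  rintro _ ⟨p, hp, rfl⟩
  exact h p.1 p.2 hp

theorem wordSpan_mono {P Q : List ι → Prop} (h : ∀ w, P w → Q w) :
    wordSpan X P ≤ wordSpan X Q :=
  wordSpan_le fun w hw => monomial_mem_wordSpan (h w hw)

theorem tensorSpan_mono {P Q : List ι → List ι → Prop} (h : ∀ a b, P a b → Q a b) :
    tensorSpan X P ≤ tensorSpan X Q :=
  tensorSpan_le fun a b hw => tmul_mem_tensorSpan (h a b hw)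

/-- A linear map is controlled on a span of words by its values on these words. -/
theorem map_wordSpan {M : Type*} [AddCommGroup M] [Module k M] (f : T →ₗ[k] M)
    {P : List ι → Prop} {N : Submodule k M} (h : ∀ w, P w → f (monomial X w) ∈ N) {z : T}
    (hz : z ∈ wordSpan X P) : f z ∈ N :=
  wordSpan_le (N := N.comap f) h hz

theorem map_tensorSpan {M : Type*} [AddCommGroup M] [Module k M] (f : T ⊗[k] T →ₗ[k] M)
    {P : List ι → List ι → Prop} {N : Submodule k M}
    (h : ∀ a b, P a b → f (monomial X a ⊗ₜ[k] monomial X b) ∈ N) {z : T ⊗[k] T}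
    (hz : z ∈ tensorSpan X P) : f z ∈ N :=
  tensorSpan_le (N := N.comap f) h hz

theorem tmul_mem {P Q : List ι → Prop} {S : List ι → List ι → Prop}
    (h : ∀ a b, P a → Q b → S a b) {y z : T} (hy : y ∈ wordSpan X P) (hz : z ∈ wordSpan X Q) :
    y ⊗ₜ[k] z ∈ tensorSpan X S :=
  map_wordSpan ((TensorProduct.mk k T T).flip z)
    (fun a ha => map_wordSpan (TensorProduct.mk k T T (monomial X a))
      (fun b hb => tmul_mem_tensorSpan (h a b ha hb)) hz) hy

theorem mul_mem_wordSpan {P Q S : List ι → Prop}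
    (h : ∀ a b, P a → Q b → S (a ++ b)) {y z : T} (hy : y ∈ wordSpan X P)
    (hz : z ∈ wordSpan X Q) : y * z ∈ wordSpan X S :=
  map_wordSpan (LinearMap.mulRight k z)
    (fun a ha => map_wordSpan (LinearMap.mulLeft k (monomial X a))
      (fun b hb => by
        rw [LinearMap.mulLeft_apply, ← monomial_append]
        exact monomial_mem_wordSpan (h a b ha hb)) hz) hy

theorem mul'_mem_wordSpan {P : List ι → List ι → Prop} {S : List ι → Prop}
    (h : ∀ a b, P a b → S (a ++ b)) {z : T ⊗[k] T} (hz : z ∈ tensorSpan X P) :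
    LinearMap.mul' k T z ∈ wordSpan X S :=
  map_tensorSpan _ (fun a b hab => by
    rw [LinearMap.mul'_apply, ← monomial_append]
    exact monomial_mem_wordSpan (h a b hab)) hz

theorem left_mul_mem_tensorSpan {P S : List ι → List ι → Prop} {w : List ι}
    (h : ∀ a b, P a b → S (w ++ a) b) {z : T ⊗[k] T} (hz : z ∈ tensorSpan X P) :
    (monomial X w ⊗ₜ[k] (1 : T)) * z ∈ tensorSpan X S :=
  map_tensorSpan (LinearMap.mulLeft k (monomial X w ⊗ₜ[k] (1 : T))) (fun a b hab => by
    rw [LinearMap.mulLeft_apply, Algebra.TensorProduct.tmul_mul_tmul, one_mul, ← monomial_append]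
    exact tmul_mem_tensorSpan (h a b hab)) hz

theorem right_mul_mem_tensorSpan {P S : List ι → List ι → Prop} {w : List ι}
    (h : ∀ a b, P a b → S a (b ++ w)) {z : T ⊗[k] T} (hz : z ∈ tensorSpan X P) :
    z * ((1 : T) ⊗ₜ[k] monomial X w) ∈ tensorSpan X S :=
  map_tensorSpan (LinearMap.mulRight k ((1 : T) ⊗ₜ[k] monomial X w)) (fun a b hab => by
    rw [LinearMap.mulRight_apply, Algebra.TensorProduct.tmul_mul_tmul, mul_one, ← monomial_append]
    exact tmul_mem_tensorSpan (h a b hab)) hz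

theorem ι_mem_wordSpan (v : V) : TensorAlgebra.ι k v ∈ wordSpan X (fun w => w.length = 1) := by
  have hv : v ∈ Submodule.span k (Set.range X) := by simp [X.span_eq]
  have : Submodule.span k (Set.range X) ≤
      (wordSpan X (fun w => w.length = 1)).comap (TensorAlgebra.ι k) := by
    refine Submodule.span_le.2 ?_
    rintro _ ⟨x, rfl⟩
    have := monomial_mem_wordSpan (X := X) (P := fun w => w.length = 1) (w := [x]) rfl
    rwa [monomial_singleton] at this
  exact this hv

/-- The coefficient `∏ γ (x, y)`, over the letters `x` of `a` and `y` of `b`, with which the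
diagonal braiding given by `γ` exchanges the words `a` and `b`. -/
def wordCoeff (γ : ι → ι → k) (a b : List ι) : k :=
  (a.map fun x => (b.map (γ x)).prod).prod

theorem wordCoeff_cons_left (γ : ι → ι → k) (x : ι) (a b : List ι) :
    wordCoeff γ (x :: a) b = wordCoeff γ [x] b * wordCoeff γ a b := by
  simp [wordCoeff]

theorem wordCoeff_singleton_cons (γ : ι → ι → k) (x y : ι) (b : List ι) :
    wordCoeff γ [x] (y :: b) = γ x y * wordCoeff γ [x] b := by
  simp [wordCoeff]

theorem wordCoeff_ne_zero {γ : ι → ι → k} (h : ∀ x y, γ x y ≠ 0) (a b : List ι) :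
    wordCoeff γ a b ≠ 0 := by
  refine List.prod_ne_zero fun h0 => ?_
  obtain ⟨x, -, hx⟩ := List.mem_map.1 h0
  refine List.prod_ne_zero (fun h1 => ?_) hx
  obtain ⟨y, -, hy⟩ := List.mem_map.1 h1
  exact h x y hy

theorem wordCoeff_perm (γ : ι → ι → k) {a a' b b' : List ι} (ha : a.Perm a') (hb : b.Perm b') :
    wordCoeff γ a b = wordCoeff γ a' b' := by
  unfold wordCoeff
  rw [(ha.map _).prod_eq]
  congr 1
  exact List.map_congr_left fun x _ => (hb.map _).prod_eq

/-- Exchanging the two arguments and inverting `γ` inverts the coefficient. -/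
theorem wordCoeff_inv (γ : ι → ι → k) (a b : List ι) :
    wordCoeff (fun x y => (γ y x)⁻¹) a b = (wordCoeff γ b a)⁻¹ := by
  induction a with
  | nil => simp [wordCoeff]
  | cons x a ih =>
    rw [wordCoeff_cons_left, ih]
    simp only [wordCoeff, List.map_cons, List.prod_cons, List.prod_map_mul, mul_inv, List.map_nil,
      List.prod_nil, mul_one, List.prod_inv, List.map_map]
    rfl

theorem braidRight_mem {r : V ⊗[k] V →ₗ[k] V ⊗[k] V} {P S : List ι → List ι → Prop} {a : T}
    (h : ∀ p q, P p q →
      tensorBraiding r (a ⊗ₜ[k] monomial X p) * ((1 : T) ⊗ₜ[k] monomial X q) ∈ tensorSpan X S)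
    {z : T ⊗[k] T} (hz : z ∈ tensorSpan X P) : braidRight r a z ∈ tensorSpan X S :=
  map_tensorSpan _ (fun p q hpq => by rw [braidRight_tmul]; exact h p q hpq) hz

theorem tensorBraiding_one_right (r : V ⊗[k] V →ₗ[k] V ⊗[k] V) (v : V) :
    tensorBraiding r (TensorAlgebra.ι k v ⊗ₜ[k] (1 : T)) = (1 : T) ⊗ₜ[k] TensorAlgebra.ι k v := by
  rw [tensorBraiding_ι_left, braidLetter_one, LinearMap.lTensor_tmul]

/-- A diagonal braiding exchanges two words up to a coefficient. -/
theorem tensorBraiding_diagonal {d : V ⊗[k] V →ₗ[k] V ⊗[k] V} {γ : ι → ι → k}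
    (hd : ∀ x y, d (X x ⊗ₜ[k] X y) = γ x y • (X y ⊗ₜ[k] X x)) (a b : List ι) :
    tensorBraiding d (monomial X a ⊗ₜ[k] monomial X b) =
      wordCoeff γ a b • (monomial X b ⊗ₜ[k] monomial X a) := by
  have letter : ∀ (x : ι) (b : List ι),
      tensorBraiding d (TensorAlgebra.ι k (X x) ⊗ₜ[k] monomial X b) =
        wordCoeff γ [x] b • (monomial X b ⊗ₜ[k] TensorAlgebra.ι k (X x)) := by
    intro x b
    induction b with
    | nil => rw [monomial_nil, tensorBraiding_one_right]; simp [wordCoeff]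
    | cons y b ih =>
      rw [monomial_cons, tensorBraiding_ι_ι_mul, hd, map_smul, map_smul, TensorProduct.map_tmul,
        braidLeft_tmul, ih, wordCoeff_singleton_cons, mul_smul_comm, smul_smul,
        Algebra.TensorProduct.tmul_mul_tmul, one_mul]
  induction a with
  | nil => rw [monomial_nil, tensorBraiding_one_left]; simp [wordCoeff]
  | cons x a ih =>
    rw [monomial_cons, tensorBraiding_mul_left, ih, map_smul, braidRight_tmul, letter,
      wordCoeff_cons_left γ x a b, smul_mul_assoc, smul_smul, mul_comm (wordCoeff γ a b),
      Algebra.TensorProduct.tmul_mul_tmul, mul_one]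

theorem tensorBraiding_diagonal_homogeneous {d : V ⊗[k] V →ₗ[k] V ⊗[k] V} {γ : ι → ι → k}
    (hd : ∀ x y, d (X x ⊗ₜ[k] X y) = γ x y • (X y ⊗ₜ[k] X x)) {v w : List ι} {y z : T}
    (hy : y ∈ wordSpan X (fun a => a.Perm v)) (hz : z ∈ wordSpan X (fun a => a.Perm w)) :
    tensorBraiding d (y ⊗ₜ[k] z) = wordCoeff γ v w • (z ⊗ₜ[k] y) := by
  have := map_tensorSpan (X := X) (P := fun a b => a.Perm v ∧ b.Perm w) (N := ⊥)
    (tensorBraiding d - wordCoeff γ v w • (TensorProduct.comm k T T).toLinearMap)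
    (fun a b h => by
      simp [tensorBraiding_diagonal hd, wordCoeff_perm γ h.1 h.2])
    (tmul_mem (fun a b ha hb => ⟨ha, hb⟩) hy hz)
  simpa [sub_eq_zero] using this

variable [LinearOrder ι] [Fintype ι]

variable {r : V ⊗[k] V →ₗ[k] V ⊗[k] V} {γ : ι → ι → k}

theorem tensorBraiding_ι_monomial (hr : IsLeftTriangularWith X r γ) (w : List ι) : ∀ x : ι,
    tensorBraiding r (TensorAlgebra.ι k (X x) ⊗ₜ[k] monomial X w) -
        wordCoeff γ [x] w • (monomial X w ⊗ₜ[k] TensorAlgebra.ι k (X x)) ∈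
      tensorSpan X (fun b t => b.length = w.length ∧ t.length = 1 ∧ Dominates b w) := by
  induction w with
  | nil => intro x; simp [monomial_nil, tensorBraiding_one_right, wordCoeff]
  | cons y w ih =>
    intro x
    obtain ⟨v, hv⟩ := hr
    -- The letters `z > y` put in front make the first tensor factor larger, whatever follows.
    have any : ∀ u : V, tensorBraiding r (TensorAlgebra.ι k u ⊗ₜ[k] monomial X w) ∈
        tensorSpan X (fun b t => b.length = w.length ∧ t.length = 1) := by
      intro u
      refine map_wordSpan (X := X)
        (tensorBraiding r ∘ₗ (TensorProduct.mk k T T).flip (monomial X w))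
        (P := fun w => w.length = 1) (fun a ha => ?_) (ι_mem_wordSpan u)
      obtain ⟨x, rfl⟩ := List.length_eq_one_iff.1 ha
      rw [monomial_singleton]
      have h1 := tensorSpan_mono (Q := fun b t => b.length = w.length ∧ t.length = 1)
        (fun a b h => ⟨h.1, h.2.1⟩) (ih x)
      have h2 : wordCoeff γ [x] w • (monomial X w ⊗ₜ[k] TensorAlgebra.ι k (X x)) ∈
          tensorSpan X (fun b t => b.length = w.length ∧ t.length = 1) := by
        rw [← monomial_singleton]
        exact Submodule.smul_mem _ _ (tmul_mem_tensorSpan ⟨rfl, rfl⟩)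
      simpa using add_mem h1 h2
    rw [monomial_cons, tensorBraiding_ι_ι_mul, hv, map_add, map_add, map_smul, map_smul,
      TensorProduct.map_tmul, braidLeft_tmul, map_sum, map_sum, wordCoeff_singleton_cons,
      add_sub_right_comm, ← smul_smul]
    refine add_mem ?_ (Submodule.sum_mem _ fun z hz => ?_)
    · have := left_mul_mem_tensorSpan (w := [y])
        (S := fun b t => b.length = (y :: w).length ∧ t.length = 1 ∧ Dominates b (y :: w))
        (fun a b h => ⟨by simp [h.1], h.2.1, h.2.2.append_left [y]⟩) (ih x)
      rw [mul_sub, mul_smul_comm, Algebra.TensorProduct.tmul_mul_tmul, one_mul,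
        monomial_singleton] at this
      have := Submodule.smul_mem _ (γ x y) this
      rwa [smul_sub] at this
    · rw [TensorProduct.map_tmul, braidLeft_tmul, ← monomial_singleton]
      refine left_mul_mem_tensorSpan (fun a b h => ⟨by simp [h.1], h.2, ?_⟩) (any _)
      exact cons_dominates_cons.2 (Or.inl (by simpa using hz))

/-- The braiding induced by a left triangular map is left triangular: up to a coefficient it
exchanges two words, modulo terms with a dominating word as first tensor factor. -/
theorem tensorBraiding_monomial (hr : IsLeftTriangularWith X r γ) (a w : List ι) :
    tensorBraiding r (monomial X a ⊗ₜ[k] monomial X w) -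
        wordCoeff γ a w • (monomial X w ⊗ₜ[k] monomial X a) ∈
      tensorSpan X (fun b t => b.length = w.length ∧ t.length = a.length ∧ Dominates b w) := by
  induction a with
  | nil => rw [monomial_nil, tensorBraiding_one_left]; simp [wordCoeff]
  | cons x a ih =>
    have letter : ∀ p : List ι, tensorBraiding r (TensorAlgebra.ι k (X x) ⊗ₜ[k] monomial X p) ∈
        tensorSpan X (fun b t => b.length = p.length ∧ t.length = 1 ∧ (b = p ∨ Dominates b p)) := by
      intro p
      have h1 := tensorSpan_mono
        (Q := fun b t => b.length = p.length ∧ t.length = 1 ∧ (b = p ∨ Dominates b p))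
        (fun b t h => ⟨h.1, h.2.1, Or.inr h.2.2⟩) (tensorBraiding_ι_monomial hr p x)
      have h2 : wordCoeff γ [x] p • (monomial X p ⊗ₜ[k] TensorAlgebra.ι k (X x)) ∈
          tensorSpan X (fun b t => b.length = p.length ∧ t.length = 1 ∧
            (b = p ∨ Dominates b p)) := by
        rw [← monomial_singleton]
        exact Submodule.smul_mem _ _ (tmul_mem_tensorSpan ⟨rfl, rfl, Or.inl rfl⟩)
      simpa using add_mem h1 h2
    rw [monomial_cons, tensorBraiding_mul_left]
    have h1 := braidRight_mem (r := r) (a := TensorAlgebra.ι k (X x))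
      (S := fun b t => b.length = w.length ∧ t.length = (x :: a).length ∧ Dominates b w)
      (fun p q h => right_mul_mem_tensorSpan (fun b t hbt =>
        ⟨hbt.1.trans h.1, by simp [hbt.2.1, h.2.1, add_comm], by
          rcases hbt.2.2 with rfl | h'
          · exact h.2.2
          · exact h'.trans h.2.2⟩) (letter p)) ih
    have h2 := right_mul_mem_tensorSpan (w := a)
      (S := fun b t => b.length = w.length ∧ t.length = (x :: a).length ∧ Dominates b w)
      (fun b t h => ⟨h.1, by simp [h.2.1, add_comm], h.2.2⟩) (tensorBraiding_ι_monomial hr w x)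
    have h3 := add_mem h1 (Submodule.smul_mem _ (wordCoeff γ a w) h2)
    convert h3 using 1
    rw [map_sub, map_smul, braidRight_tmul, sub_mul, smul_sub, smul_mul_assoc,
      Algebra.TensorProduct.tmul_mul_tmul, mul_one, wordCoeff_cons_left, smul_smul,
      mul_comm (wordCoeff γ a w)]
    abel

theorem tensorBraiding_monomial_mem (hr : IsLeftTriangularWith X r γ) (a w : List ι) :
    tensorBraiding r (monomial X a ⊗ₜ[k] monomial X w) ∈
      tensorSpan X (fun b t => b.length = w.length ∧ t.length = a.length ∧
        (b = w ∨ Dominates b w)) := by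
  have h1 := tensorSpan_mono
    (Q := fun b t => b.length = w.length ∧ t.length = a.length ∧ (b = w ∨ Dominates b w))
    (fun b t h => ⟨h.1, h.2.1, Or.inr h.2.2⟩) (tensorBraiding_monomial hr a w)
  have h2 : wordCoeff γ a w • (monomial X w ⊗ₜ[k] monomial X a) ∈
      tensorSpan X (fun b t => b.length = w.length ∧ t.length = a.length ∧
        (b = w ∨ Dominates b w)) :=
    Submodule.smul_mem _ _ (tmul_mem_tensorSpan ⟨rfl, rfl, Or.inl rfl⟩)
  simpa using add_mem h1 h2

theorem tensorBraiding_mem (hr : IsLeftTriangularWith X r γ) {P Q : List ι → Prop}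
    {S : List ι → List ι → Prop}
    (h : ∀ a w b t, P a → Q w → b.length = w.length → t.length = a.length →
      (b = w ∨ Dominates b w) → S b t) {y z : T} (hy : y ∈ wordSpan X P)
    (hz : z ∈ wordSpan X Q) : tensorBraiding r (y ⊗ₜ[k] z) ∈ tensorSpan X S :=
  map_tensorSpan (P := fun a w => P a ∧ Q w) _ (fun a w haw =>
    tensorSpan_mono (fun b t hbt => h a w b t haw.1 haw.2 hbt.1 hbt.2.1 hbt.2.2)
      (tensorBraiding_monomial_mem hr a w)) (tmul_mem (fun _ _ ha hb => ⟨ha, hb⟩) hy hz)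

end Triangular

section Bracket

variable {k : Type*} [Field k] {V : Type*} [AddCommGroup V] [Module k V]

local notation "T" => TensorAlgebra k V

variable {ι : Type*} [LinearOrder ι] (X : Module.Basis ι k V) (r : V ⊗[k] V →ₗ[k] V ⊗[k] V)

theorem bracket_nil : bracket X r [] = 1 := by
  rw [bracket]
  simp [monomial_nil]

theorem bracket_singleton (x : ι) : bracket X r [x] = TensorAlgebra.ι k (X x) := by
  rw [bracket]
  simp [monomial_singleton]

theorem bracket_append_flatten {l : List ι} {ls : List (List ι)} (h : IsLyndonList (l :: ls)) :
    bracket X r (l ++ ls.flatten) = bracket X r l * bracket X r ls.flatten := by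
  rcases eq_or_ne ls [] with rfl | hls
  · simp [bracket_nil]
  have hl := h.1 l (by simp)
  have hpos : 0 < ls.flatten.length := by
    obtain ⟨m, ms, rfl⟩ := List.exists_cons_of_ne_nil hls
    have := (h.1 m (by simp)).length_pos
    simp
    omega
  have hlp : lyndonPrefixLength (l ++ ls.flatten) = l.length := h.lyndonPrefixLength_eq
  have h2 : ¬ (l ++ ls.flatten).length < 2 := by
    have := hl.length_pos
    simp only [List.length_append]
    omega
  have hnl : ¬ IsLyndon (l ++ ls.flatten) := fun hL => by
    have := h.prefix_length_le hL (q := []) (by simp)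
    simp only [List.length_append] at this
    omega
  rw [bracket, dif_neg h2, dif_neg hnl, hlp]
  simp

theorem bracket_flatten {ls : List (List ι)} (h : IsLyndonList ls) :
    bracket X r ls.flatten = (ls.map (bracket X r)).prod := by
  induction ls with
  | nil => simp [bracket_nil]
  | cons l ls ih =>
    rw [List.flatten_cons, bracket_append_flatten X r h, ih h.of_cons]
    simp

/-- Induction along the Shirshov decompositions of Lyndon words. -/
theorem IsLyndon.bracket_induction {P : List ι → T → Prop}
    (letter : ∀ x, P [x] (TensorAlgebra.ι k (X x)))
    (shirshov : ∀ v w, IsLyndon v → IsLyndon w → IsLyndon (v ++ w) → P v (bracket X r v) →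
      P w (bracket X r w) → P (v ++ w) (bracket X r v * bracket X r w -
        LinearMap.mul' k T (tensorBraiding r (bracket X r v ⊗ₜ[k] bracket X r w))))
    {u : List ι} (hu : IsLyndon u) : P u (bracket X r u) := by
  induction hn : u.length using Nat.strong_induction_on generalizing u with
  | _ n ih =>
    subst hn
    have hpos := hu.length_pos
    rcases (show u.length = 1 ∨ 2 ≤ u.length by omega) with h1 | h2
    · obtain ⟨x, rfl⟩ := List.length_eq_one_iff.1 h1
      rw [bracket_singleton]
      exact letter x
    · obtain ⟨h0, hlt, hw⟩ := shirshovIndex_spec u h2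
      have hv := hu.take_shirshovIndex h2
      have e : bracket X r u = bracket X r (u.take (shirshovIndex u)) *
          bracket X r (u.drop (shirshovIndex u)) -
          LinearMap.mul' k T (tensorBraiding r (bracket X r (u.take (shirshovIndex u)) ⊗ₜ[k]
            bracket X r (u.drop (shirshovIndex u)))) := by
        rw [bracket, dif_neg (by omega), dif_pos hu]
        simp
      have := shirshov _ _ hv hw (by rwa [List.take_append_drop])
        (ih _ (by simp; omega) hv rfl) (ih _ (by simp; omega) hw rfl)
      rwa [List.take_append_drop, ← e] at this

variable {X r}

/-- Modulo words of the same length that are larger, the commutator `[u]_r` is the word `u`. -/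
theorem bracket_sub_monomial_mem [Fintype ι] {γ : ι → ι → k} (hr : IsLeftTriangularWith X r γ)
    (u : List ι) : bracket X r u - monomial X u ∈
      wordSpan X (fun w => w.length = u.length ∧ Dominates w u) := by
  have lead : ∀ {u : List ι} {z : T},
      z - monomial X u ∈ wordSpan X (fun w => w.length = u.length ∧ Dominates w u) →
      z ∈ wordSpan X (fun w => w.length = u.length ∧ (w = u ∨ Dominates w u)) := by
    intro u z hz
    have h1 := wordSpan_mono
      (Q := fun w => w.length = u.length ∧ (w = u ∨ Dominates w u))
      (fun w h => ⟨h.1, Or.inr h.2⟩) hz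
    have h2 := monomial_mem_wordSpan (X := X)
      (P := fun w => w.length = u.length ∧ (w = u ∨ Dominates w u)) (w := u) ⟨rfl, Or.inl rfl⟩
    simpa using add_mem h1 h2
  have mul : ∀ {u v : List ι} {y z : T},
      y - monomial X u ∈ wordSpan X (fun w => w.length = u.length ∧ Dominates w u) →
      z - monomial X v ∈ wordSpan X (fun w => w.length = v.length ∧ Dominates w v) →
      y * z - monomial X (u ++ v) ∈
        wordSpan X (fun w => w.length = (u ++ v).length ∧ Dominates w (u ++ v)) := by
    intro u v y z hy hz
    have h1 := mul_mem_wordSpan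
      (S := fun w => w.length = (u ++ v).length ∧ Dominates w (u ++ v))
      (fun a b ha hb => ⟨by simp [ha.1, hb.1], ha.2.append b v⟩) hy (lead hz)
    have h2 := mul_mem_wordSpan (P := fun w => w = u)
      (S := fun w => w.length = (u ++ v).length ∧ Dominates w (u ++ v))
      (fun a b ha hb => ⟨by simp [ha, hb.1], by rw [ha]; exact hb.2.append_left u⟩)
      (monomial_mem_wordSpan rfl) hz
    convert add_mem h1 h2 using 1
    rw [monomial_append]
    noncomm_ring
  have lyndon : ∀ u : List ι, IsLyndon u → bracket X r u - monomial X u ∈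
      wordSpan X (fun w => w.length = u.length ∧ Dominates w u) := by
    intro u hu
    refine hu.bracket_induction X r (P := fun u z => z - monomial X u ∈
      wordSpan X (fun w => w.length = u.length ∧ Dominates w u)) ?_ ?_
    · intro x
      rw [monomial_singleton, sub_self]
      exact zero_mem _
    · intro v w hv hw hvw ihv ihw
      rw [sub_right_comm]
      refine sub_mem (mul ihv ihw) (mul'_mem_wordSpan (P := fun b t => b.length = w.length ∧
        t.length = v.length ∧ (b = w ∨ Dominates b w)) ?_
        (tensorBraiding_mem hr ?_ (lead ihv) (lead ihw)))
      · rintro b t ⟨hb, ht, hbw⟩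
        have hwd := hvw.dominates hv.1 hw.1
        refine ⟨by simp [hb, ht, add_comm], ?_⟩
        have : Dominates b (v ++ w) := by
          rcases hbw with rfl | hbw
          · exact hwd
          · exact hbw.trans hwd
        simpa using this.append t []
      · rintro a w' b t ⟨ha, -⟩ ⟨hw', hww⟩ hb ht hbw
        refine ⟨hb.trans hw', ht.trans ha, ?_⟩
        rcases hbw with rfl | hbw
        · exact hww
        · rcases hww with rfl | hww
          · exact Or.inr hbw
          · exact Or.inr (hbw.trans hww)
  obtain ⟨ls, hls, rfl⟩ := exists_isLyndonList u
  rw [bracket_flatten X r hls]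
  induction ls with
  | nil =>
    simp only [List.map_nil, List.prod_nil, List.flatten_nil, monomial_nil, sub_self]
    exact zero_mem _
  | cons l ls ih =>
    rw [List.map_cons, List.prod_cons, List.flatten_cons]
    exact mul (lyndon l (hls.1 l (by simp))) (ih hls.of_cons)

/-- The commutator of a Lyndon word with respect to a diagonal braiding is homogeneous: each of its
words has the same letters, with multiplicities. -/
theorem IsLyndon.bracket_mem_perm {d : V ⊗[k] V →ₗ[k] V ⊗[k] V} {γ : ι → ι → k}
    (hd : ∀ x y, d (X x ⊗ₜ[k] X y) = γ x y • (X y ⊗ₜ[k] X x)) {u : List ι} (hu : IsLyndon u) :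
    bracket X d u ∈ wordSpan X (fun w => w.Perm u) := by
  refine hu.bracket_induction X d (P := fun u z => z ∈ wordSpan X (fun w => w.Perm u)) ?_ ?_
  · intro x
    rw [← monomial_singleton]
    exact monomial_mem_wordSpan (List.Perm.refl _)
  · intro v w hv hw hvw ihv ihw
    rw [tensorBraiding_diagonal_homogeneous hd ihv ihw, map_smul, LinearMap.mul'_apply]
    exact sub_mem (mul_mem_wordSpan (fun a b ha hb => ha.append hb) ihv ihw)
      (Submodule.smul_mem _ _ (mul_mem_wordSpan
        (fun a b ha hb => (ha.append hb).trans List.perm_append_comm) ihw ihv))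

end Bracket

/-! ### The comultiplication of iterated commutators -/

section Comul

variable {k : Type*} [Field k] {V : Type*} [AddCommGroup V] [Module k V]

local notation "T" => TensorAlgebra k V

section

variable (c : V ⊗[k] V →ₗ[k] V ⊗[k] V)

theorem tensorBraiding_right_one (a : T) :
    tensorBraiding c (a ⊗ₜ[k] (1 : T)) = (1 : T) ⊗ₜ[k] a := by
  induction a using TensorAlgebra.induction with
  | algebraMap s =>
    rw [tensorBraiding_algebraMap_left, Algebra.algebraMap_eq_smul_one, TensorProduct.tmul_smul]
  | ι x => exact tensorBraiding_one_right c x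
  | add a b ha hb => rw [TensorProduct.add_tmul, map_add, ha, hb, TensorProduct.tmul_add]
  | mul a b ha hb =>
    rw [tensorBraiding_mul_left, hb, braidRight_tmul, ha, Algebra.TensorProduct.tmul_mul_tmul,
      one_mul]

theorem braidedMul_left_one (x y z : T) :
    braidedMul c ((x ⊗ₜ[k] (1 : T)) ⊗ₜ[k] (y ⊗ₜ[k] z)) = (x * y) ⊗ₜ[k] z := by
  simp [braidedMul_tmul, tensorBraiding_one_left]

theorem braidedMul_right_one (x y z : T) :
    braidedMul c ((x ⊗ₜ[k] y) ⊗ₜ[k] ((1 : T) ⊗ₜ[k] z)) = x ⊗ₜ[k] (y * z) := by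
  simp [braidedMul_tmul, tensorBraiding_right_one]

theorem braidedMul_one_one (y z : T) :
    braidedMul c (((1 : T) ⊗ₜ[k] y) ⊗ₜ[k] (z ⊗ₜ[k] (1 : T))) =
      tensorBraiding c (y ⊗ₜ[k] z) := by
  rw [braidedMul_tmul, ← Algebra.TensorProduct.one_def, one_mul, mul_one]

end

variable {ι : Type*} {X : Module.Basis ι k V}

theorem one_tmul_mem {P : List ι → Prop} {z : T} (hz : z ∈ wordSpan X P) :
    (1 : T) ⊗ₜ[k] z ∈ tensorSpan X (fun a b => a = [] ∧ P b) := by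
  rw [← monomial_nil X]
  exact tmul_mem (P := fun a => a = []) (fun a b ha hb => ⟨ha, hb⟩) (monomial_mem_wordSpan rfl) hz

theorem tmul_one_mem {P : List ι → Prop} {z : T} (hz : z ∈ wordSpan X P) :
    z ⊗ₜ[k] (1 : T) ∈ tensorSpan X (fun a b => P a ∧ b = []) := by
  rw [← monomial_nil X]
  exact tmul_mem (Q := fun a => a = []) (fun a b ha hb => ⟨ha, hb⟩) hz (monomial_mem_wordSpan rfl)

variable [LinearOrder ι] [Fintype ι]
  {c : V ⊗[k] V →ₗ[k] V ⊗[k] V} {γ : ι → ι → k}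

/-- A product in the braided tensor square only enlarges first tensor factors. -/
theorem braidedMul_mem (hc : IsLeftTriangularWith X c γ) {P Q S : List ι → List ι → Prop}
    (h : ∀ a b a' b' p q, P a b → Q a' b' → p.length = a'.length → q.length = b.length →
      (p = a' ∨ Dominates p a') → S (a ++ p) (q ++ b'))
    {y z : T ⊗[k] T} (hy : y ∈ tensorSpan X P) (hz : z ∈ tensorSpan X Q) :
    braidedMul c (y ⊗ₜ[k] z) ∈ tensorSpan X S := by
  refine map_tensorSpan (X := X) (braidedMul c ∘ₗ (TensorProduct.mk k _ _).flip z)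
    (fun a b hab => ?_) hy
  refine map_tensorSpan (X := X)
    (braidedMul c ∘ₗ TensorProduct.mk k _ _ (monomial X a ⊗ₜ[k] monomial X b))
    (fun a' b' hab' => ?_) hz
  simp only [LinearMap.comp_apply, TensorProduct.mk_apply]
  rw [braidedMul_tmul]
  refine right_mul_mem_tensorSpan (P := fun x q => ∃ p, x = a ++ p ∧ p.length = a'.length ∧
    q.length = b.length ∧ (p = a' ∨ Dominates p a')) ?_
    (left_mul_mem_tensorSpan (fun p q hpq => ?_) (tensorBraiding_monomial_mem hc b a'))
  · rintro _ q ⟨p, rfl, hp, hq, hd⟩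
    exact h a b a' b' p q hab hab' hp hq hd
  · exact ⟨p, rfl, hpq.1, hpq.2.1, hpq.2.2⟩

theorem comul_monomial_mem (hc : IsLeftTriangularWith X c γ) (w : List ι) :
    comul c (monomial X w) ∈ tensorSpan X (fun a b => a.length + b.length = w.length) := by
  induction w with
  | nil =>
    rw [monomial_nil, comul_one, ← monomial_nil X]
    exact tmul_mem_tensorSpan rfl
  | cons x w ih =>
    have hx := monomial_mem_wordSpan (X := X) (P := fun w => w.length = 1) (w := [x]) rfl
    rw [monomial_singleton] at hx
    have h1 : comul c (TensorAlgebra.ι k (X x)) ∈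
        tensorSpan X (fun a b => a.length + b.length = 1) := by
      rw [comul_ι]
      exact add_mem (tensorSpan_mono (fun a b h => by simp [h.1, h.2]) (tmul_one_mem hx))
        (tensorSpan_mono (fun a b h => by simp [h.1, h.2]) (one_tmul_mem hx))
    rw [monomial_cons, comul_mul]
    refine braidedMul_mem hc (fun a b a' b' p q hab hab' hp hq _ => ?_) h1 ih
    simp only [List.length_append, List.length_cons, hp, hq]
    omega

theorem comul_mem (hc : IsLeftTriangularWith X c γ) {n : ℕ} {z : T}
    (hz : z ∈ wordSpan X (fun w => w.length = n)) :
    comul c z ∈ tensorSpan X (fun a b => a.length + b.length = n) :=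
  map_wordSpan _ (fun w hw => by
    have := comul_monomial_mem hc (X := X) w
    rwa [hw] at this) hz

theorem bracket_mem_length {r : V ⊗[k] V →ₗ[k] V ⊗[k] V} {γ : ι → ι → k}
    (hr : IsLeftTriangularWith X r γ) (u : List ι) :
    bracket X r u ∈ wordSpan X (fun w => w.length = u.length) := by
  have h1 := wordSpan_mono (Q := fun w => w.length = u.length) (fun w h => h.1)
    (bracket_sub_monomial_mem hr u)
  simpa using add_mem h1
    (monomial_mem_wordSpan (X := X) (P := fun w => w.length = u.length) (w := u) rfl)

variable {d : V ⊗[k] V →ₗ[k] V ⊗[k] V}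

theorem isLeftTriangularWith_of_diagonal {γ : ι → ι → k}
    (hd : ∀ x y, d (X x ⊗ₜ[k] X y) = γ x y • (X y ⊗ₜ[k] X x)) : IsLeftTriangularWith X d γ :=
  ⟨fun _ _ _ => 0, fun x y => by simp [hd]⟩

/-- For a Lyndon word `u`, the commutator `[u]` with respect to the inverse of the diagonal
component of `c` is primitive modulo terms whose first tensor factor dominates `u`. -/
theorem IsLyndon.comul_bracket (hc : IsLeftTriangularWith X c γ) (hγ : ∀ x y, γ x y ≠ 0)
    (hd : ∀ x y, d (X x ⊗ₜ[k] X y) = (γ y x)⁻¹ • (X y ⊗ₜ[k] X x)) {u : List ι}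
    (hu : IsLyndon u) :
    comul c (bracket X d u) - monomial X u ⊗ₜ[k] (1 : T) - (1 : T) ⊗ₜ[k] bracket X d u ∈
      tensorSpan X (fun a b => Dominates a u ∧ a.length + b.length = u.length) := by
  refine hu.bracket_induction X d (P := fun u z =>
    comul c z - monomial X u ⊗ₜ[k] (1 : T) - (1 : T) ⊗ₜ[k] z ∈
      tensorSpan X (fun a b => Dominates a u ∧ a.length + b.length = u.length)) ?_ ?_
  · intro x
    rw [comul_ι, monomial_singleton]
    simp
  · intro v w hv hw hvw ihv ihw
    have hdw : Dominates w (v ++ w) := hvw.dominates hv.1 hw.1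
    have hAp := hv.bracket_mem_perm hd
    have hCp := hw.bracket_mem_perm hd
    rw [tensorBraiding_diagonal_homogeneous (γ := fun x y => (γ y x)⁻¹) hd hAp hCp, wordCoeff_inv,
      map_smul, LinearMap.mul'_apply]
    have hA := wordSpan_mono (Q := fun a => a.length = v.length) (fun a h => h.length_eq) hAp
    have hC := wordSpan_mono (Q := fun a => a.length = w.length) (fun a h => h.length_eq) hCp
    set A := bracket X d v
    set C := bracket X d w
    set S : List ι → List ι → Prop :=
      fun a b => Dominates a (v ++ w) ∧ a.length + b.length = (v ++ w).length with hS
    have hΔA := comul_mem hc hA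
    have hΔC := comul_mem hc hC
    have hv1 := tmul_one_mem (monomial_mem_wordSpan (X := X) (P := fun a => a = v) rfl)
    have hw1 := tmul_one_mem (monomial_mem_wordSpan (X := X) (P := fun a => a = w) rfl)
    have h1A := one_tmul_mem hA
    have h1C := one_tmul_mem hC
    set eA := comul c A - monomial X v ⊗ₜ[k] (1 : T) - (1 : T) ⊗ₜ[k] A with heA
    set eC := comul c C - monomial X w ⊗ₜ[k] (1 : T) - (1 : T) ⊗ₜ[k] C with heC
    have hA' : comul c A = monomial X v ⊗ₜ[k] (1 : T) + (1 : T) ⊗ₜ[k] A + eA := by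
      rw [heA]; abel
    have hC' : comul c C = monomial X w ⊗ₜ[k] (1 : T) + (1 : T) ⊗ₜ[k] C + eC := by
      rw [heC]; abel
    clear_value eA eC
    -- The terms of the two products that are negligible.
    have n1 : braidedMul c ((monomial X v ⊗ₜ[k] (1 : T)) ⊗ₜ[k] eC) ∈ tensorSpan X S := by
      refine braidedMul_mem hc (fun a b a' b' p q h h' hp hq hpd => ⟨?_, ?_⟩) hv1 ihw
      · rw [h.1]
        rcases hpd with rfl | hpd
        · exact h'.1.append_left v
        · exact (hpd.trans h'.1).append_left v
      · simp [h.1, h.2, hp, hq, ← h'.2, add_assoc]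
    have n2 : braidedMul c (((1 : T) ⊗ₜ[k] A) ⊗ₜ[k] (monomial X w ⊗ₜ[k] (1 : T))) ∈
        tensorSpan X S := by
      refine braidedMul_mem hc (fun a b a' b' p q h h' hp hq hpd => ⟨?_, ?_⟩) h1A hw1
      · rw [h.1, List.nil_append]
        rcases hpd with rfl | hpd
        · rwa [h'.1]
        · rw [h'.1] at hpd
          exact hpd.trans hdw
      · simp [h.1, h.2, hp, hq, h'.1, h'.2, add_comm]
    have n3 : braidedMul c (((1 : T) ⊗ₜ[k] A) ⊗ₜ[k] eC) ∈ tensorSpan X S := by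
      refine braidedMul_mem hc (fun a b a' b' p q h h' hp hq hpd => ⟨?_, ?_⟩) h1A ihw
      · rw [h.1, List.nil_append]
        rcases hpd with rfl | hpd
        · exact h'.1.trans hdw
        · exact (hpd.trans h'.1).trans hdw
      · simp only [List.length_append, h.1, hp, hq, h.2, List.length_nil]
        have := h'.2
        omega
    have n4 : braidedMul c (eA ⊗ₜ[k] comul c C) ∈ tensorSpan X S := by
      refine braidedMul_mem hc (fun a b a' b' p q h h' hp hq hpd => ⟨h.1.append p w, ?_⟩) ihv hΔC
      simp only [List.length_append, hp, hq]
      have := h.2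
      omega
    have n5 : braidedMul c ((monomial X w ⊗ₜ[k] (1 : T)) ⊗ₜ[k] comul c A) ∈ tensorSpan X S := by
      refine braidedMul_mem hc (fun a b a' b' p q h h' hp hq hpd => ⟨?_, ?_⟩) hw1 hΔA
      · rw [h.1]
        simpa using hdw.append p []
      · simp only [List.length_append, hp, hq, h.1, h.2, List.length_nil]
        omega
    have n6 : braidedMul c (((1 : T) ⊗ₜ[k] C) ⊗ₜ[k] eA) ∈ tensorSpan X S := by
      refine braidedMul_mem hc (fun a b a' b' p q h h' hp hq hpd => ⟨?_, ?_⟩) h1C ihv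
      · rw [h.1, List.nil_append]
        have : Dominates p v := by
          rcases hpd with rfl | hpd
          · exact h'.1
          · exact hpd.trans h'.1
        simpa using this.append [] w
      · simp only [List.length_append, h.1, hp, hq, h.2, List.length_nil]
        have := h'.2
        omega
    have n7 : braidedMul c (eC ⊗ₜ[k] comul c A) ∈ tensorSpan X S := by
      refine braidedMul_mem hc (fun a b a' b' p q h h' hp hq hpd => ⟨?_, ?_⟩) ihw hΔA
      · simpa using (h.1.trans hdw).append p []
      · simp only [List.length_append, hp, hq]
        have := h.2
        omega
    have n8 : tensorBraiding c (C ⊗ₜ[k] monomial X v) -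
        wordCoeff γ w v • (monomial X v ⊗ₜ[k] C) ∈ tensorSpan X S := by
      refine map_wordSpan (X := X)
        (tensorBraiding c ∘ₗ (TensorProduct.mk k T T).flip (monomial X v) -
          wordCoeff γ w v • TensorProduct.mk k T T (monomial X v)) (fun a ha => ?_) hCp
      have := tensorBraiding_monomial hc (X := X) a v
      rw [wordCoeff_perm γ ha (List.Perm.refl v)] at this
      refine tensorSpan_mono (fun b t h => ⟨?_, ?_⟩) this
      · simpa using h.2.2.append [] w
      · simp [h.1, h.2.1, ha.length_eq]
    have e1 : comul c (A * C) = (monomial X (v ++ w)) ⊗ₜ[k] (1 : T) + monomial X v ⊗ₜ[k] C +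
        (1 : T) ⊗ₜ[k] (A * C) +
        (braidedMul c ((monomial X v ⊗ₜ[k] (1 : T)) ⊗ₜ[k] eC) +
        braidedMul c (((1 : T) ⊗ₜ[k] A) ⊗ₜ[k] (monomial X w ⊗ₜ[k] (1 : T))) +
        braidedMul c (((1 : T) ⊗ₜ[k] A) ⊗ₜ[k] eC) +
        braidedMul c (eA ⊗ₜ[k] comul c C)) := by
      rw [comul_mul, hA', TensorProduct.add_tmul, TensorProduct.add_tmul, map_add, map_add]
      nth_rewrite 1 2 [hC']
      simp only [TensorProduct.tmul_add, map_add, braidedMul_left_one, braidedMul_right_one,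
        monomial_append, one_mul]
      abel
    have e2 : comul c (C * A) = (1 : T) ⊗ₜ[k] (C * A) +
        tensorBraiding c (C ⊗ₜ[k] monomial X v) +
        (braidedMul c ((monomial X w ⊗ₜ[k] (1 : T)) ⊗ₜ[k] comul c A) +
        braidedMul c (((1 : T) ⊗ₜ[k] C) ⊗ₜ[k] eA) +
        braidedMul c (eC ⊗ₜ[k] comul c A)) := by
      rw [comul_mul, hC', TensorProduct.add_tmul, TensorProduct.add_tmul, map_add, map_add]
      nth_rewrite 2 [hA']
      simp only [TensorProduct.tmul_add, map_add, braidedMul_right_one, braidedMul_one_one]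
      abel
    -- The term `v ⊗ [w]` of `[v] [w]` cancels against that of `[w] [v]`.
    have hne := wordCoeff_ne_zero hγ w v
    have h1 := add_mem (add_mem (add_mem n1 n2) n3) n4
    have h2 := add_mem n8 (add_mem (add_mem n5 n6) n7)
    have h3 := sub_mem h1 (Submodule.smul_mem _ (wordCoeff γ w v)⁻¹ h2)
    convert h3 using 1
    rw [map_sub (comul c), map_smul (comul c), e1, e2, TensorProduct.tmul_sub (1 : T),
      TensorProduct.tmul_smul]
    simp only [smul_add, smul_sub, smul_smul, inv_mul_cancel₀ hne, one_smul]
    abel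

theorem one_tmul_bracket_mem {γ : ι → ι → k} (hd : IsLeftTriangularWith X d γ) (u : List ι) :
    (1 : T) ⊗ₜ[k] bracket X d u ∈ tensorSpan X (fun a b => a = [] ∧ b.length = u.length) :=
  one_tmul_mem (bracket_mem_length hd u)

/-- A product of commutators of Lyndon words greater than `s` has comultiplication `1 ⊗ z` modulo
terms whose first tensor factor dominates `s s s ...`. -/
theorem comul_bracket_flatten_gt (hc : IsLeftTriangularWith X c γ) (hγ : ∀ x y, γ x y ≠ 0)
    (hd : ∀ x y, d (X x ⊗ₜ[k] X y) = (γ y x)⁻¹ • (X y ⊗ₜ[k] X x)) {s : List ι} (hs : IsLyndon s)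
    {ls : List (List ι)} (hls : IsLyndonList ls) (hgt : ∀ l ∈ ls, s < l) :
    comul c (bracket X d ls.flatten) - (1 : T) ⊗ₜ[k] bracket X d ls.flatten ∈
      tensorSpan X (fun a b => DominatesPow s a ∧ a.length + b.length = ls.flatten.length) := by
  have hd' := isLeftTriangularWith_of_diagonal (γ := fun x y => (γ y x)⁻¹) hd
  induction ls with
  | nil =>
    rw [List.flatten_nil, bracket_nil, comul_one, sub_self]
    exact zero_mem _
  | cons l ls ih =>
    have hl := hls.1 l (by simp)
    have hld := hl.dominatesPow hs.1 (hgt l (by simp))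
    have ih := ih hls.of_cons fun m hm => hgt m (by simp [hm])
    have h1 : comul c (bracket X d l) - (1 : T) ⊗ₜ[k] bracket X d l ∈
        tensorSpan X (fun a b => DominatesPow s a ∧ a.length + b.length = l.length) := by
      have h1 := tensorSpan_mono
        (Q := fun a b => DominatesPow s a ∧ a.length + b.length = l.length)
        (fun a b h => ⟨h.1.dominatesPow hld, h.2⟩) (hl.comul_bracket hc hγ hd)
      have h2 := tensorSpan_mono
        (Q := fun a b => DominatesPow s a ∧ a.length + b.length = l.length)
        (fun a b h => ⟨by rwa [h.1], by simp [h.1, h.2]⟩)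
        (tmul_one_mem (monomial_mem_wordSpan (X := X) (P := fun a => a = l) rfl))
      convert add_mem h1 h2 using 1
      abel
    have hQ := comul_mem hc (bracket_mem_length hd' ls.flatten)
    have n1 := braidedMul_mem hc
      (S := fun a b => DominatesPow s a ∧ a.length + b.length = (l ++ ls.flatten).length)
      (fun a b a' b' p q h h' hp hq _ => ⟨h.1.append p, by
        simp only [List.length_append, hp, hq]
        have := h.2
        omega⟩) h1 hQ
    have n2 := braidedMul_mem hc
      (S := fun a b => DominatesPow s a ∧ a.length + b.length = (l ++ ls.flatten).length)
      (fun a b a' b' p q h h' hp hq hpd => ⟨by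
        rw [h.1, List.nil_append]
        rcases hpd with rfl | hpd
        · exact h'.1
        · exact hpd.dominatesPow h'.1, by
        simp only [List.length_append, hp, hq, h.1, h.2, List.length_nil]
        have := h'.2
        omega⟩) (one_tmul_bracket_mem hd' l) ih
    rw [List.flatten_cons, bracket_append_flatten X d hls, comul_mul]
    convert add_mem n1 n2 using 1
    rw [TensorProduct.sub_tmul, TensorProduct.tmul_sub, map_sub, map_sub, braidedMul_right_one]
    abel

/-- The comultiplication of `[s] ^ j` is `s ^ j ⊗ 1` modulo terms whose first tensor factor is a
smaller power of `s` or dominates `s s s ...`. -/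
theorem comul_bracket_pow (hc : IsLeftTriangularWith X c γ) (hγ : ∀ x y, γ x y ≠ 0)
    (hd : ∀ x y, d (X x ⊗ₜ[k] X y) = (γ y x)⁻¹ • (X y ⊗ₜ[k] X x)) {s : List ι} (hs : IsLyndon s)
    (j : ℕ) :
    comul c (bracket X d s ^ j) - monomial X (wordPow s j) ⊗ₜ[k] (1 : T) ∈
      tensorSpan X (fun a b => (DominatesPow s a ∨ ∃ i < j, a = wordPow s i) ∧
        a.length + b.length = (wordPow s j).length) := by
  have hd' := isLeftTriangularWith_of_diagonal (γ := fun x y => (γ y x)⁻¹) hd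
  induction j with
  | zero =>
    have : monomial X (wordPow s 0) = 1 := monomial_nil X
    rw [pow_zero, comul_one, this, sub_self]
    exact zero_mem _
  | succ j ih =>
    set G : List ι → List ι → Prop :=
      fun a b => (DominatesPow s a ∨ ∃ i < j + 1, a = wordPow s i) ∧
        a.length + b.length = (wordPow s (j + 1)).length with hG
    have hlen : (wordPow s (j + 1)).length = s.length + (wordPow s j).length := by
      rw [wordPow_succ, List.length_append]
    set g := comul c (bracket X d s ^ j) - monomial X (wordPow s j) ⊗ₜ[k] (1 : T) with hg
    have hall : comul c (bracket X d s ^ j) ∈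
        tensorSpan X (fun a b => (DominatesPow s a ∨ ∃ i < j + 1, a = wordPow s i) ∧
          a.length + b.length = (wordPow s j).length) := by
      have h1 := tensorSpan_mono
        (Q := fun a b => (DominatesPow s a ∨ ∃ i < j + 1, a = wordPow s i) ∧
          a.length + b.length = (wordPow s j).length)
        (fun a b h => ⟨h.1.imp id fun ⟨i, hi, e⟩ => ⟨i, by omega, e⟩, h.2⟩) ih
      have h2 := tensorSpan_mono
        (Q := fun a b => (DominatesPow s a ∨ ∃ i < j + 1, a = wordPow s i) ∧
          a.length + b.length = (wordPow s j).length)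
        (fun a b h => ⟨Or.inr ⟨j, by omega, h.1⟩, by simp [h.1, h.2]⟩)
        (tmul_one_mem (monomial_mem_wordSpan (X := X) (P := fun a => a = wordPow s j) rfl))
      rw [hg] at h1
      convert add_mem h1 h2 using 1
      abel
    have n1 : braidedMul c ((monomial X s ⊗ₜ[k] (1 : T)) ⊗ₜ[k] g) ∈ tensorSpan X G := by
      refine braidedMul_mem hc (fun a b a' b' p q h h' hp hq hpd => ⟨?_, ?_⟩)
        (tmul_one_mem (monomial_mem_wordSpan (X := X) (P := fun a => a = s) rfl)) ih
      · rw [h.1]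
        rcases hpd with rfl | hpd
        · exact h'.1.imp (fun h => h.append_left)
            fun ⟨i, hi, e⟩ => ⟨i + 1, by omega, by rw [wordPow_succ, e]⟩
        · refine Or.inl (DominatesPow.append_left ?_)
          rcases h'.1 with h'' | ⟨i, -, rfl⟩
          · exact hpd.dominatesPow h''
          · exact ⟨i, hpd⟩
      · simp only [List.length_append, hp, hq, h.1, h.2, List.length_nil, hlen]
        have := h'.2
        omega
    have n2 : braidedMul c (((1 : T) ⊗ₜ[k] bracket X d s) ⊗ₜ[k] comul c (bracket X d s ^ j)) ∈
        tensorSpan X G := by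
      refine braidedMul_mem hc (fun a b a' b' p q h h' hp hq hpd => ⟨?_, ?_⟩)
        (one_tmul_bracket_mem hd' s) hall
      · rw [h.1, List.nil_append]
        rcases hpd with rfl | hpd
        · exact h'.1
        · refine Or.inl ?_
          rcases h'.1 with h'' | ⟨i, -, rfl⟩
          · exact hpd.dominatesPow h''
          · exact ⟨i, hpd⟩
      · simp only [List.length_append, hp, hq, h.1, h.2, List.length_nil, hlen]
        have := h'.2
        omega
    have n3 := braidedMul_mem hc (S := G)
      (fun a b a' b' p q h h' hp hq hpd => ⟨Or.inl (DominatesPow.append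
          (⟨1, by simpa [wordPow] using h.1⟩ : DominatesPow s a) p), by
        simp only [List.length_append, hp, hq, hlen]
        have := h.2
        have := h'.2
        omega⟩) (hs.comul_bracket hc hγ hd) hall
    rw [pow_succ', comul_mul]
    convert add_mem (add_mem n1 n2) n3 using 1
    rw [hg, wordPow_succ, monomial_append]
    simp only [TensorProduct.sub_tmul, TensorProduct.tmul_sub, map_sub, braidedMul_left_one]
    abel

/-- The comultiplication of `[v] [s] ^ j`, for a product `v` of Lyndon words greater than `s`: up to
a nonzero coefficient it is `s ^ j ⊗ v`, modulo terms `s ^ j ⊗ w` with `w` larger than `v` and terms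
whose first tensor factor is a smaller power of `s` or dominates `s s s ...`. -/
theorem comul_bracket_mul_pow (hc : IsLeftTriangularWith X c γ) (hγ : ∀ x y, γ x y ≠ 0)
    (hd : ∀ x y, d (X x ⊗ₜ[k] X y) = (γ y x)⁻¹ • (X y ⊗ₜ[k] X x)) {s : List ι} (hs : IsLyndon s)
    {ls : List (List ι)} (hls : IsLyndonList ls) (hgt : ∀ l ∈ ls, s < l) (j : ℕ) :
    comul c (bracket X d ls.flatten * bracket X d s ^ j) -
        wordCoeff γ ls.flatten (wordPow s j) •
          (monomial X (wordPow s j) ⊗ₜ[k] monomial X ls.flatten) ∈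
      tensorSpan X (fun a b => (DominatesPow s a ∨ (∃ i < j, a = wordPow s i) ∨
          (a = wordPow s j ∧ Dominates b ls.flatten)) ∧
        a.length + b.length = ls.flatten.length + (wordPow s j).length) := by
  have hd' := isLeftTriangularWith_of_diagonal (γ := fun x y => (γ y x)⁻¹) hd
  have hflat := comul_bracket_flatten_gt hc hγ hd hs hls hgt
  set v := ls.flatten
  set Q := bracket X d v
  set G : List ι → List ι → Prop := fun a b => (DominatesPow s a ∨ (∃ i < j, a = wordPow s i) ∨
          (a = wordPow s j ∧ Dominates b v)) ∧
        a.length + b.length = v.length + (wordPow s j).length with hG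
  have hpow := comul_bracket_pow hc hγ hd hs j
  set g := comul c (bracket X d s ^ j) - monomial X (wordPow s j) ⊗ₜ[k] (1 : T) with hg
  have hΔ : comul c (bracket X d s ^ j) ∈
      tensorSpan X (fun a b => a.length + b.length = (wordPow s j).length) := by
    have h2 := tensorSpan_mono (Q := fun a b => a.length + b.length = (wordPow s j).length)
      (fun a b h => by simp [h.1, h.2])
      (tmul_one_mem (monomial_mem_wordSpan (X := X) (P := fun a => a = wordPow s j) rfl))
    simpa [hg] using add_mem
      (tensorSpan_mono (Q := fun a b => a.length + b.length = (wordPow s j).length)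
        (fun a b h => h.2) hpow) h2
  have n1 := braidedMul_mem hc (S := G) (fun a b a' b' p q h h' hp hq hpd =>
      ⟨Or.inl (h.1.append p), by
        simp only [List.length_append, hp, hq]
        have := h.2
        omega⟩) hflat hΔ
  have n2 : braidedMul c (((1 : T) ⊗ₜ[k] Q) ⊗ₜ[k] g) ∈ tensorSpan X G := by
    refine braidedMul_mem hc (fun a b a' b' p q h h' hp hq hpd => ⟨?_, ?_⟩)
      (one_tmul_bracket_mem hd' v) hpow
    · rw [h.1, List.nil_append]
      rcases hpd with rfl | hpd
      · exact h'.1.imp id Or.inl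
      · refine Or.inl ?_
        rcases h'.1 with h'' | ⟨i, -, rfl⟩
        · exact hpd.dominatesPow h''
        · exact ⟨i, hpd⟩
    · simp only [List.length_append, hp, hq, h.1, h.2, List.length_nil]
      have := h'.2
      omega
  have n3 : tensorBraiding c (monomial X v ⊗ₜ[k] monomial X (wordPow s j)) -
      wordCoeff γ v (wordPow s j) • (monomial X (wordPow s j) ⊗ₜ[k] monomial X v) ∈
        tensorSpan X G :=
    tensorSpan_mono (fun a b h => ⟨Or.inl ⟨j, h.2.2⟩, by rw [h.1, h.2.1, add_comm]⟩)
      (tensorBraiding_monomial hc v (wordPow s j))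
  have n4 : tensorBraiding c ((Q - monomial X v) ⊗ₜ[k] monomial X (wordPow s j)) ∈
      tensorSpan X G := by
    refine map_wordSpan (X := X) (tensorBraiding c ∘ₗ
      (TensorProduct.mk k T T).flip (monomial X (wordPow s j))) (fun w hw => ?_)
      (bracket_sub_monomial_mem hd' v)
    have h1 := tensorSpan_mono (Q := G)
      (fun a b h => ⟨Or.inl ⟨j, h.2.2⟩, by rw [h.1, h.2.1, hw.1, add_comm]⟩)
      (tensorBraiding_monomial hc (X := X) w (wordPow s j))
    have h2 : monomial X (wordPow s j) ⊗ₜ[k] monomial X w ∈ tensorSpan X G :=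
      tmul_mem_tensorSpan ⟨Or.inr (Or.inr ⟨rfl, hw.2⟩), by rw [hw.1, add_comm]⟩
    simpa using add_mem h1 (Submodule.smul_mem _ (wordCoeff γ w (wordPow s j)) h2)
  rw [comul_mul]
  convert add_mem (add_mem n1 n2) (add_mem n3 n4) using 1
  rw [hg]
  simp only [TensorProduct.sub_tmul, TensorProduct.tmul_sub, map_sub, braidedMul_one_one]
  abel

end Comul

/-! ### The standard order and normal words -/

section StandardOrder

variable {ι : Type*} [LinearOrder ι]

theorem StdGT.trans {u v w : List ι} (h : StdGT u v) (h' : StdGT v w) : StdGT u w := by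
  rcases h with h | ⟨h, h2⟩ <;> rcases h' with h' | ⟨h', h2'⟩
  · exact Or.inl (h.trans h')
  · exact Or.inl (by omega)
  · exact Or.inl (by omega)
  · exact Or.inr ⟨h.trans h', h2'.trans h2⟩

theorem not_stdGT_self (u : List ι) : ¬ StdGT u u := by
  rintro (h | ⟨-, h⟩)
  · exact lt_irrefl _ h
  · exact lt_irrefl _ h

theorem stdGT_or_of_ne {u v : List ι} (h : u ≠ v) : StdGT u v ∨ StdGT v u := by
  rcases lt_trichotomy u.length v.length with hl | hl | hl
  · exact Or.inl (Or.inl hl)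
  · rcases lt_or_gt_of_ne h with hlt | hlt
    · exact Or.inr (Or.inr ⟨hl.symm, hlt⟩)
    · exact Or.inl (Or.inr ⟨hl, hlt⟩)
  · exact Or.inr (Or.inl hl)

theorem StdGT.length_le {u v : List ι} (h : StdGT u v) : u.length ≤ v.length := by
  rcases h with h | ⟨h, -⟩ <;> omega

theorem Dominates.stdGT {u v : List ι} (h : Dominates u v) (hl : u.length = v.length) :
    StdGT u v :=
  Or.inr ⟨hl, h.lt⟩

theorem StdGT.append {u v : List ι} (h : StdGT u v) (a b : List ι) :
    StdGT (a ++ u ++ b) (a ++ v ++ b) := by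
  rcases h with h | ⟨h, h'⟩
  · exact Or.inl (by simpa using h)
  · exact (((dominates_of_lt h' h.le).append_left a).append b b).stdGT (by simp [h])

variable [Fintype ι]

theorem finite_stdGT (u : List ι) : {w | StdGT w u}.Finite :=
  (List.finite_length_le ι u.length).subset fun _ hw => StdGT.length_le hw

/-- The number of words that are larger than `u` in the standard order. -/
noncomputable def stdRank (u : List ι) : ℕ := {w | StdGT w u}.ncard

theorem StdGT.stdRank_lt {u v : List ι} (h : StdGT u v) : stdRank u < stdRank v :=
  Set.ncard_lt_ncard ⟨fun _ hw => StdGT.trans hw h, fun hs => not_stdGT_self u (hs h)⟩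
    (finite_stdGT v)

theorem stdGT_induction {P : List ι → Prop} (h : ∀ u, (∀ w, StdGT w u → P w) → P u)
    (u : List ι) : P u := by
  induction hn : stdRank u using Nat.strong_induction_on generalizing u with
  | _ n ih =>
    subst hn
    exact h u fun w hw => ih _ hw.stdRank_lt w rfl

/-- A nonempty finite set of words has a smallest element in the standard order. -/
theorem exists_stdGT_min {F : Finset (List ι)} (hF : F.Nonempty) :
    ∃ u ∈ F, ∀ v ∈ F, v ≠ u → StdGT v u := by
  obtain ⟨u, hu, hmax⟩ := F.exists_max_image stdRank hF
  refine ⟨u, hu, fun v hv hne => (stdGT_or_of_ne hne).resolve_right fun h => ?_⟩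
  exact absurd h.stdRank_lt (hmax v hv).not_gt

end StandardOrder

section Normal

variable {k : Type*} [Field k] {V : Type*} [AddCommGroup V] [Module k V]

local notation "T" => TensorAlgebra k V

variable {ι : Type*}

theorem span_monomial_eq_top (X : Module.Basis ι k V) :
    Submodule.span k (Set.range (monomial X)) = ⊤ := by
  have h : Submodule.span k (Set.range (monomial X)) = wordSpan X (fun _ => True) := by
    simp [wordSpan]
  rw [h, eq_top_iff]
  rintro a -
  induction a using TensorAlgebra.induction with
  | algebraMap s =>
    rw [Algebra.algebraMap_eq_smul_one, ← monomial_nil X]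
    exact Submodule.smul_mem _ _ (monomial_mem_wordSpan trivial)
  | ι x => exact wordSpan_mono (fun _ _ => trivial) (ι_mem_wordSpan x)
  | add a b ha hb => exact add_mem ha hb
  | mul a b ha hb => exact mul_mem_wordSpan (fun _ _ _ _ => trivial) ha hb

variable [LinearOrder ι] (X : Module.Basis ι k V) (I : Ideal (TensorAlgebra k V))

/-- Normal words modulo `I`: the words that are not, modulo `I`, linear combinations of words that
are larger in the standard order. -/
def IsNormal (u : List ι) : Prop :=
  monomial X u ∉ spanAbove X u ⊔ I.restrictScalars k

variable {X I}

theorem monomial_mem_spanAbove {w u : List ι} (h : StdGT w u) :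
    monomial X w ∈ spanAbove X u :=
  Submodule.subset_span ⟨w, h, rfl⟩

theorem IsNormal.infix [I.IsTwoSided] {a v b : List ι} (h : IsNormal X I (a ++ v ++ b)) :
    IsNormal X I v := by
  intro hv
  refine h ?_
  let f : T →ₗ[k] T := LinearMap.mulLeft k (monomial X a) ∘ₗ LinearMap.mulRight k (monomial X b)
  have hle : spanAbove X v ⊔ I.restrictScalars k ≤
      (spanAbove X (a ++ v ++ b) ⊔ I.restrictScalars k).comap f := by
    refine sup_le (Submodule.span_le.2 ?_) fun z hz => ?_
    · rintro _ ⟨w, hw, rfl⟩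
      refine Submodule.mem_sup_left ?_
      have e : f (monomial X w) = monomial X (a ++ w ++ b) := by
        simp [f, monomial_append]
      rw [e]
      exact monomial_mem_spanAbove (StdGT.append hw a b)
    · exact Submodule.mem_sup_right (I.mul_mem_left _ (I.mul_mem_right _ hz))
  have e : f (monomial X v) = monomial X (a ++ v ++ b) := by
    simp [f, monomial_append]
  rw [← e]
  exact hle hv

theorem isNormal_nil (hI : I ≠ ⊤) : IsNormal X I [] := by
  intro h
  have h0 : spanAbove X [] = ⊥ := by
    refine Submodule.span_eq_bot.2 ?_
    rintro _ ⟨w, hw, rfl⟩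
    rcases hw with hw | ⟨hl, hw⟩
    · simp at hw
    · rw [List.length_eq_zero_iff.1 hl] at hw
      exact absurd hw (lt_irrefl _)
  rw [h0, bot_sup_eq, monomial_nil] at h
  exact hI (I.eq_top_iff_one.2 h)

theorem isNormal_wordPow {u : List ι} {t : ℕ} (h : (t : ℕ∞) < height X I u) :
    IsNormal X I (wordPow u t) := by
  intro hu
  exact absurd (sInf_le ⟨t, hu, rfl⟩ : height X I u ≤ t) h.not_ge

theorem lt_height [I.IsTwoSided] {u : List ι} {t : ℕ} (h : IsNormal X I (wordPow u t)) :
    (t : ℕ∞) < height X I u := by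
  by_contra! hle
  have hne : ((fun t : ℕ => (t : ℕ∞)) ''
      {t : ℕ | monomial X (wordPow u t) ∈
        spanAbove X (wordPow u t) ⊔ I.restrictScalars k}).Nonempty := by
    by_contra hne
    rw [Set.not_nonempty_iff_eq_empty] at hne
    rw [height, hne, sInf_empty, top_le_iff] at hle
    exact ENat.natCast_ne_top t hle
  obtain ⟨s, hs, hs'⟩ := csInf_mem hne
  have hst : s ≤ t := by
    have : ((s : ℕ) : ℕ∞) = height X I u := hs'
    rw [← this] at hle
    exact_mod_cast hle
  obtain ⟨i, rfl⟩ := Nat.exists_eq_add_of_le hst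
  rw [wordPow_add] at h
  have h' : IsNormal X I ([] ++ wordPow u s ++ wordPow u i) := h
  exact h'.infix hs

/-- The list of factors of a PBW product, each of them repeated according to its exponent. -/
def expand {σ : Type*} (l : List (σ × ℕ)) : List σ :=
  l.flatMap fun p => List.replicate p.2 p.1

theorem prod_map_pow {σ A : Type*} [Monoid A] (f : σ → A) (l : List (σ × ℕ)) :
    (l.map fun p => f p.1 ^ p.2).prod = ((expand l).map f).prod := by
  induction l with
  | nil => simp [expand]
  | cons p l ih =>
    rw [List.map_cons, List.prod_cons, ih]
    simp [expand, List.prod_replicate]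

theorem exists_expand_eq {σ : Type*} [LinearOrder σ] (ls : List σ)
    (h : ls.Pairwise (fun a b => b ≤ a)) :
    ∃ l : List (σ × ℕ), (l.map Prod.fst).Pairwise (fun x y => y < x) ∧ (∀ p ∈ l, 0 < p.2) ∧
      expand l = ls := by
  induction ls with
  | nil => exact ⟨[], by simp, by simp, rfl⟩
  | cons a ls ih =>
    obtain ⟨l, h1, h2, rfl⟩ := ih (List.pairwise_cons.1 h).2
    cases l with
    | nil => exact ⟨[(a, 1)], by simp, by simp, by simp [expand]⟩
    | cons p l =>
      obtain ⟨b, e⟩ := p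
      have he : 0 < e := h2 (b, e) (by simp)
      have hba : b ≤ a := (List.pairwise_cons.1 h).1 b (by simp [expand, he.ne'])
      rcases hba.eq_or_lt with rfl | hlt
      · refine ⟨(b, e + 1) :: l, by simpa using h1, ?_, by simp [expand, List.replicate_succ]⟩
        intro q hq
        rcases List.mem_cons.1 hq with rfl | hq
        · simp
        · exact h2 q (by simp [hq])
      · refine ⟨(a, 1) :: (b, e) :: l, ?_, ?_, by simp [expand]⟩
        · rw [List.map_cons, List.pairwise_cons]
          refine ⟨fun x hx => ?_, h1⟩
          rw [List.map_cons, List.mem_cons] at hx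
          rcases hx with rfl | hx
          · exact hlt
          · rw [List.map_cons, List.pairwise_cons] at h1
            exact (h1.1 x hx).trans hlt
        · intro q hq
          rcases List.mem_cons.1 hq with rfl | hq
          · simp
          · exact h2 q hq

/-- The exponent lists of PBW products: the words in `S_I` strictly decrease, and the exponents are
positive and smaller than the heights. -/
def IsPBWList (X : Module.Basis ι k V) (I : Ideal T) (l : List (hardWords X I × ℕ)) : Prop :=
  (l.map Prod.fst).Pairwise (fun x y => y < x) ∧
    ∀ p ∈ l, 0 < p.2 ∧ (p.2 : ℕ∞) < height X I p.1.1

/-- The Lyndon decomposition, as a list of words, belonging to an exponent list. -/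
def factors (l : List (hardWords X I × ℕ)) : List (List ι) := (expand l).map Subtype.val

theorem IsPBWList.isLyndonList {l : List (hardWords X I × ℕ)} (h : IsPBWList X I l) :
    IsLyndonList (factors l) := by
  constructor
  · intro u hu
    obtain ⟨s, -, rfl⟩ := List.mem_map.1 hu
    exact s.2.1
  · unfold factors
    rw [List.pairwise_map]
    have h1 := h.1
    clear h
    induction l with
    | nil => simp [expand]
    | cons p l ih =>
      rw [List.map_cons, List.pairwise_cons] at h1
      have : expand (p :: l) = List.replicate p.2 p.1 ++ expand l := by simp [expand]
      rw [this, List.pairwise_append]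
      refine ⟨List.pairwise_replicate.2 (Or.inr le_rfl), ih h1.2, fun a ha b hb => ?_⟩
      rw [List.eq_of_mem_replicate ha]
      obtain ⟨q, hq, hb⟩ := List.mem_flatMap.1 hb
      rw [List.eq_of_mem_replicate hb]
      exact (h1.1 q.1 (List.mem_map_of_mem hq)).le

theorem mem_pbwWords_iff {u : List ι} :
    u ∈ pbwWords X I ↔ ∃ l, IsPBWList X I l ∧ u = (factors l).flatten := by
  have key : ∀ l : List (hardWords X I × ℕ),
      (l.map fun p => FreeMonoid.ofList p.1.1 ^ p.2).prod =
        FreeMonoid.ofList (factors l).flatten := by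
    intro l
    rw [prod_map_pow (fun u : hardWords X I => FreeMonoid.ofList u.1) l, factors]
    induction expand l with
    | nil => rfl
    | cons a l ih => rw [List.map_cons, List.prod_cons, ih]; rfl
  constructor
  · rintro ⟨l, h1, h2, h3⟩
    refine ⟨l, ⟨h1, h2⟩, ?_⟩
    rw [key] at h3
    exact FreeMonoid.ofList.injective h3
  · rintro ⟨l, ⟨h1, h2⟩, h3⟩
    refine ⟨l, h1, h2, ?_⟩
    rw [key, h3]

/-- Factors of normal words are normal, so the Lyndon decomposition of a normal word consists of
words in `S_I`, each of them repeated fewer times than its height. -/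
theorem IsNormal.mem_pbwWords [I.IsTwoSided] {u : List ι} (hu : IsNormal X I u) :
    u ∈ pbwWords X I := by
  obtain ⟨ls, hls, rfl⟩ := exists_isLyndonList u
  have hhard : ∀ l ∈ ls, l ∈ hardWords X I := by
    intro l hl
    refine ⟨hls.1 l hl, ?_⟩
    obtain ⟨s, t, rfl⟩ := List.append_of_mem hl
    have : IsNormal X I (s.flatten ++ l ++ t.flatten) := by simpa using hu
    exact this.infix
  lift ls to List (hardWords X I) using hhard
  obtain ⟨l, h1, h2, rfl⟩ := exists_expand_eq ls (List.pairwise_map.1 hls.2)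
  refine mem_pbwWords_iff.2 ⟨l, ⟨h1, fun p hp => ⟨h2 p hp, lt_height ?_⟩⟩, rfl⟩
  obtain ⟨s, t, rfl⟩ := List.append_of_mem hp
  have : IsNormal X I ((factors s).flatten ++ wordPow p.1.1 p.2 ++ (factors t).flatten) := by
    simpa [factors, expand, wordPow] using hu
  exact this.infix

/-- A nonempty word of `B_I` is `v s ^ e` with `s` its last Lyndon factor; here `v` belongs
to `B_I`, too. -/
theorem exists_last_factor {u : List ι} (hu : u ∈ pbwWords X I) (hne : u ≠ []) :
    ∃ (ls : List (List ι)) (s : List ι) (e : ℕ), IsLyndonList ls ∧ ls.flatten ∈ pbwWords X I ∧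
      IsLyndon s ∧ (∀ l ∈ ls, s < l) ∧ 0 < e ∧ (e : ℕ∞) < height X I s ∧
      IsLyndonList (ls ++ List.replicate e s) ∧ u = (ls ++ List.replicate e s).flatten := by
  obtain ⟨l, hl, rfl⟩ := mem_pbwWords_iff.1 hu
  rcases List.eq_nil_or_concat l with rfl | ⟨l, ⟨s, e⟩, rfl⟩
  · exact absurd rfl hne
  rw [List.concat_eq_append] at hl hu ⊢
  have e1 : factors (l ++ [(s, e)]) = factors l ++ List.replicate e s.1 := by
    simp [factors, expand]
  have hpw := hl.1
  rw [List.map_append, List.pairwise_append] at hpw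
  have hl' : IsPBWList X I l := ⟨hpw.1, fun p hp => hl.2 p (by simp [hp])⟩
  have hse := hl.2 (s, e) (by simp)
  refine ⟨factors l, s.1, e, hl'.isLyndonList, mem_pbwWords_iff.2 ⟨l, hl', rfl⟩, s.2.1, ?_, hse.1,
    hse.2, by rw [← e1]; exact hl.isLyndonList, by rw [e1]⟩
  intro a ha
  obtain ⟨a', ha', rfl⟩ := List.mem_map.1 ha
  obtain ⟨q, hq, hq'⟩ := List.mem_flatMap.1 ha'
  rw [List.eq_of_mem_replicate hq']
  exact hpw.2.2 q.1 (List.mem_map_of_mem hq) s (by simp)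

end Normal

/-! ### Bases consisting of elements with normal leading words -/

section Basis

variable {k : Type*} [Field k] {V : Type*} [AddCommGroup V] [Module k V]

local notation "T" => TensorAlgebra k V

theorem mem_span_sup_of_subset {α : Type*} {b : α → T} {s t : Set α} {N : Submodule k T}
    (h : s ⊆ t) {z : T} (hz : z ∈ Submodule.span k (b '' s) ⊔ N) :
    z ∈ Submodule.span k (b '' t) ⊔ N :=
  (sup_le_sup_right (Submodule.span_mono (Set.image_mono h)) N :
    Submodule.span k (b '' s) ⊔ N ≤ Submodule.span k (b '' t) ⊔ N) hz

variable {ι : Type*} [LinearOrder ι] {X : Module.Basis ι k V}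
  {I : Ideal (TensorAlgebra k V)} {b : List ι → TensorAlgebra k V}

/-- A family that is multiplicative along Lyndon decompositions yields PBW products. -/
theorem pbwSet_eq_image [I.IsTwoSided]
    (hmul : ∀ ls, IsLyndonList ls → b ls.flatten = (ls.map b).prod) :
    pbwSet (fun u : hardWords X I => Ideal.Quotient.mkₐ k I (b u.1))
        (fun u => height X I u.1) =
      (fun u => Ideal.Quotient.mkₐ k I (b u)) '' pbwWords X I := by
  have key : ∀ l : List (hardWords X I × ℕ), IsPBWList X I l →
      (l.map fun p => Ideal.Quotient.mkₐ k I (b p.1.1) ^ p.2).prod =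
        Ideal.Quotient.mkₐ k I (b (factors l).flatten) := by
    intro l hl
    rw [hmul _ hl.isLyndonList, map_list_prod,
      prod_map_pow (fun u : hardWords X I => Ideal.Quotient.mkₐ k I (b u.1)) l, factors,
      List.map_map, List.map_map]
    rfl
  ext a
  constructor
  · rintro ⟨l, h1, h2, rfl⟩
    exact ⟨_, mem_pbwWords_iff.2 ⟨l, ⟨h1, h2⟩, rfl⟩, (key l ⟨h1, h2⟩).symm⟩
  · rintro ⟨u, hu, rfl⟩
    obtain ⟨l, hl, rfl⟩ := mem_pbwWords_iff.1 hu
    exact ⟨l, hl.1, hl.2, (key l hl).symm⟩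


variable [Fintype ι]

/-- Modulo `I`, a word is a combination of elements with normal leading words that are not smaller:
replace non-normal words by larger ones, which terminates because only finitely many words are
larger than a given one. -/
theorem monomial_mem_span_normal (hb : ∀ u, b u - monomial X u ∈ spanAbove X u) (u : List ι) :
    monomial X u ∈ Submodule.span k (b '' {v | IsNormal X I v ∧ (v = u ∨ StdGT v u)}) ⊔
      I.restrictScalars k := by
  induction u using stdGT_induction with
  | h u ih =>
    have habove : spanAbove X u ≤
        Submodule.span k (b '' {v | IsNormal X I v ∧ (v = u ∨ StdGT v u)}) ⊔
          I.restrictScalars k := by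
      refine Submodule.span_le.2 ?_
      rintro _ ⟨w, hw, rfl⟩
      refine mem_span_sup_of_subset ?_ (ih w hw)
      rintro v ⟨hv, rfl | h⟩
      · exact ⟨hv, Or.inr hw⟩
      · exact ⟨hv, Or.inr (h.trans hw)⟩
    by_cases hu : IsNormal X I u
    · have h1 : b u ∈ Submodule.span k (b '' {v | IsNormal X I v ∧ (v = u ∨ StdGT v u)}) ⊔
          I.restrictScalars k :=
        Submodule.mem_sup_left (Submodule.subset_span ⟨u, ⟨hu, Or.inl rfl⟩, rfl⟩)
      simpa using sub_mem h1 (habove (hb u))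
    · exact sup_le habove le_sup_right (not_not.1 hu)

theorem spanAbove_le_span_normal (hb : ∀ u, b u - monomial X u ∈ spanAbove X u) (u : List ι) :
    spanAbove X u ≤ Submodule.span k (b '' {v | IsNormal X I v ∧ StdGT v u}) ⊔
      I.restrictScalars k := by
  refine Submodule.span_le.2 ?_
  rintro _ ⟨w, hw, rfl⟩
  refine mem_span_sup_of_subset ?_
    (monomial_mem_span_normal hb w)
  rintro v ⟨hv, rfl | h⟩
  · exact ⟨hv, hw⟩
  · exact ⟨hv, h.trans hw⟩

variable [I.IsTwoSided]

/-- The leading word of a nontrivial relation modulo `I` is not normal. -/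
theorem linearIndepOn_normal (hb : ∀ u, b u - monomial X u ∈ spanAbove X u) :
    LinearIndepOn k ((Ideal.Quotient.mkₐ k I).toLinearMap ∘ b) {u | IsNormal X I u} := by
  rw [linearIndepOn_iff]
  intro l hl h0
  by_contra hne
  obtain ⟨u, hu, hmin⟩ := exists_stdGT_min (Finsupp.support_nonempty_iff.2 hne)
  have hI : Finsupp.linearCombination k b l ∈ I := by
    rw [← Finsupp.apply_linearCombination] at h0
    exact Ideal.Quotient.eq_zero_iff_mem.1 h0
  refine hl hu ?_
  have hsum : Finsupp.linearCombination k b l =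
      l u • b u + ∑ v ∈ l.support.erase u, l v • b v := by
    rw [Finsupp.linearCombination_apply, Finsupp.sum,
      Finset.add_sum_erase _ (fun v => l v • b v) hu]
  have hrest : ∑ v ∈ l.support.erase u, l v • b v ∈ spanAbove X u := by
    refine Submodule.sum_mem _ fun v hv => Submodule.smul_mem _ _ ?_
    rw [Finset.mem_erase] at hv
    have hvu := hmin v hv.2 hv.1
    have h1 : spanAbove X v ≤ spanAbove X u :=
      Submodule.span_mono (Set.image_mono fun w hw => StdGT.trans hw hvu)
    simpa using add_mem (h1 (hb v)) (monomial_mem_spanAbove (X := X) hvu)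
  have hlu : l u ≠ 0 := Finsupp.mem_support_iff.1 hu
  have h2 : l u • monomial X u ∈ spanAbove X u ⊔ I.restrictScalars k := by
    have h3 : l u • (b u - monomial X u) + ∑ v ∈ l.support.erase u, l v • b v ∈
        spanAbove X u ⊔ I.restrictScalars k :=
      Submodule.mem_sup_left (add_mem (Submodule.smul_mem _ _ (hb u)) hrest)
    have h4 : Finsupp.linearCombination k b l ∈ spanAbove X u ⊔ I.restrictScalars k :=
      Submodule.mem_sup_right hI
    have h5 := sub_mem h4 h3
    rw [hsum] at h5
    convert h5 using 1
    rw [smul_sub]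
    abel
  exact (Submodule.smul_mem_iff _ hlu).1 h2

theorem isBasisOn_of_leading (hb : ∀ u, b u - monomial X u ∈ spanAbove X u)
    (hB : ∀ u, u ∈ pbwWords X I ↔ IsNormal X I u) :
    LinearIndepOn k b (pbwWords X I) ∧
      IsCompl (Submodule.span k (b '' pbwWords X I)) (I.restrictScalars k) ∧
      IsBasisOn k (fun u => Ideal.Quotient.mkₐ k I (b u)) (pbwWords X I) := by
  have hBs : pbwWords X I = {u | IsNormal X I u} := Set.ext hB
  have hind : LinearIndepOn k ((Ideal.Quotient.mkₐ k I).toLinearMap ∘ b) (pbwWords X I) := by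
    rw [hBs]
    exact linearIndepOn_normal hb
  have hker : (Ideal.Quotient.mkₐ k I).toLinearMap.ker = I.restrictScalars k := by
    ext z
    exact Ideal.Quotient.eq_zero_iff_mem
  have htop : Submodule.span k (b '' pbwWords X I) ⊔ I.restrictScalars k = ⊤ := by
    rw [eq_top_iff, ← span_monomial_eq_top X]
    refine Submodule.span_le.2 ?_
    rintro _ ⟨u, rfl⟩
    refine mem_span_sup_of_subset ?_
      (monomial_mem_span_normal hb u)
    exact fun v hv => (hB v).2 hv.1
  refine ⟨hind.of_comp _, ⟨?_, codisjoint_iff.2 htop⟩, hind, ?_⟩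
  · have := Submodule.range_ker_disjoint (v := fun u : pbwWords X I => b u.1)
      (f := (Ideal.Quotient.mkₐ k I).toLinearMap) hind
    rwa [hker, show Set.range (fun u : pbwWords X I => b u.1) = b '' pbwWords X I by
      rw [Set.image_eq_range]] at this
  · have h1 : (fun u => Ideal.Quotient.mkₐ k I (b u)) '' pbwWords X I =
        (Ideal.Quotient.mkₐ k I).toLinearMap '' (b '' pbwWords X I) := by
      rw [Set.image_image]; rfl
    rw [h1, ← Submodule.map_span]
    have h2 : (Submodule.span k (b '' pbwWords X I) ⊔ I.restrictScalars k).map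
        (Ideal.Quotient.mkₐ k I).toLinearMap = ⊤ := by
      rw [htop, Submodule.map_top, LinearMap.range_eq_top]
      exact Ideal.Quotient.mkₐ_surjective k I
    rw [Submodule.map_sup, ← hker, (LinearMap.le_ker_iff_map).1 le_rfl, sup_bot_eq] at h2
    exact h2

theorem isPBWBasis_of_leading (hb : ∀ u, b u - monomial X u ∈ spanAbove X u)
    (hmul : ∀ ls, IsLyndonList ls → b ls.flatten = (ls.map b).prod)
    (hB : ∀ u, u ∈ pbwWords X I ↔ IsNormal X I u) :
    IsPBWBasis k (fun u : hardWords X I => Ideal.Quotient.mkₐ k I (b u.1))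
      (fun u => height X I u.1) := by
  have hbasis := (isBasisOn_of_leading hb hB).2.2
  refine ⟨fun u v h => ?_, ?_⟩
  · exact Subtype.ext (hbasis.1.injOn ((hB _).2 u.2.2) ((hB _).2 v.2.2) h)
  · rw [pbwSet_eq_image hmul]
    refine ⟨hbasis.1.id_image, ?_⟩
    rw [Set.image_id]
    exact hbasis.2

end Basis

/-! ### The words of the PBW set are normal -/

section Core

variable {k : Type*} [Field k] {V : Type*} [AddCommGroup V] [Module k V]

local notation "T" => TensorAlgebra k V

/-- `a ⊗ b ↦ φ a • b`. -/
noncomputable def contractLeft (φ : T →ₗ[k] k) : T ⊗[k] T →ₗ[k] T :=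
  (TensorProduct.lid k T).toLinearMap ∘ₗ φ.rTensor T

theorem contractLeft_tmul (φ : T →ₗ[k] k) (a b : T) :
    contractLeft φ (a ⊗ₜ[k] b) = φ a • b := by
  simp [contractLeft]

theorem contractLeft_mem {φ : T →ₗ[k] k} {I : Ideal T} (hφ : ∀ a ∈ I, φ a = 0)
    {z : T ⊗[k] T} (hz : z ∈ tensorIdeal I) : contractLeft φ z ∈ I.restrictScalars k := by
  have h : tensorIdeal I ≤ (I.restrictScalars k).comap (contractLeft φ) := by
    refine sup_le ?_ ?_
    · rintro _ ⟨y, rfl⟩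
      induction y with
      | zero => simp
      | add x y hx hy => rw [map_add]; exact add_mem hx hy
      | tmul a b =>
        rw [LinearMap.lTensor_tmul, Submodule.mem_comap, contractLeft_tmul]
        exact Submodule.smul_mem _ _ b.2
    · rintro _ ⟨y, rfl⟩
      induction y with
      | zero => simp
      | add x y hx hy => rw [map_add]; exact add_mem hx hy
      | tmul a b =>
        rw [LinearMap.rTensor_tmul, Submodule.mem_comap, contractLeft_tmul,
          show φ ((I.restrictScalars k).subtype a) = 0 from hφ _ a.2, zero_smul]
        exact zero_mem _
  exact h hz

variable {ι : Type*} [LinearOrder ι] {X : Module.Basis ι k V}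
  {c d : V ⊗[k] V →ₗ[k] V ⊗[k] V} {γ : ι → ι → k} {I : Ideal (TensorAlgebra k V)}

/-- For finitely many nonempty words of `B_I`, let `s` be the smallest of their Lyndon factors and
`j` the largest multiplicity with which it occurs. Then each of these words is of the form `v s ^ i`
with `i ≤ j` and `v` a product of Lyndon words greater than `s`, and `i = j` for some of them. -/
theorem exists_min_factor {F : Finset (List ι)} (hF : F.Nonempty)
    (hmem : ∀ u ∈ F, u ∈ pbwWords X I ∧ u ≠ []) :
    ∃ (s : List ι) (j : ℕ), IsLyndon s ∧ 0 < j ∧ (j : ℕ∞) < height X I s ∧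
      ∃ (ls : List ι → List (List ι)) (i : List ι → ℕ),
        (∀ u ∈ F, IsLyndonList (ls u) ∧ (ls u).flatten ∈ pbwWords X I ∧ (∀ l ∈ ls u, s < l) ∧
          i u ≤ j ∧ IsLyndonList (ls u ++ List.replicate (i u) s) ∧
          u = (ls u ++ List.replicate (i u) s).flatten) ∧
        ∃ u ∈ F, i u = j := by
  have hex := fun u : F => exists_last_factor (hmem u.1 u.2).1 (hmem u.1 u.2).2
  choose ls s e h1 h2 h3 h4 h5 h6 h7 h8 using hex
  obtain ⟨u₀, -, hu₀⟩ := F.attach.exists_min_image s (by simpa using hF)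
  obtain ⟨u₁, hu₁, hmax⟩ := (F.attach.filter fun u => s u = s u₀).exists_max_image e
    ⟨u₀, by simp⟩
  rw [Finset.mem_filter] at hu₁
  have hs1 : s u₁ = s u₀ := hu₁.2
  refine ⟨s u₀, e u₁, h3 u₀, h5 u₁, hs1 ▸ h6 u₁, ?_⟩
  have hdec : ∀ u : List ι, ∃ (ls' : List (List ι)) (i : ℕ), u ∈ F →
      (IsLyndonList ls' ∧ ls'.flatten ∈ pbwWords X I ∧ (∀ l ∈ ls', s u₀ < l) ∧
          i ≤ e u₁ ∧ IsLyndonList (ls' ++ List.replicate i (s u₀)) ∧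
          u = (ls' ++ List.replicate i (s u₀)).flatten) ∧ (u = u₁.1 → i = e u₁) := by
    intro u
    by_cases hu : u ∈ F
    · by_cases hsu : s ⟨u, hu⟩ = s u₀
      · refine ⟨ls ⟨u, hu⟩, e ⟨u, hu⟩, fun _ => ⟨⟨h1 _, h2 _, ?_, ?_, ?_, ?_⟩, ?_⟩⟩
        · rw [← hsu]; exact h4 _
        · exact hmax _ (by simp [hsu])
        · rw [← hsu]; exact h7 _
        · rw [← hsu]; exact h8 ⟨u, hu⟩
        · rintro rfl; rfl
      · have hlt : s u₀ < s ⟨u, hu⟩ :=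
          lt_of_le_of_ne (hu₀ ⟨u, hu⟩ (by simp)) (Ne.symm hsu)
        refine ⟨ls ⟨u, hu⟩ ++ List.replicate (e ⟨u, hu⟩) (s ⟨u, hu⟩), 0, fun _ =>
          ⟨⟨h7 _, ?_, ?_, Nat.zero_le _, ?_, ?_⟩, ?_⟩⟩
        · rw [← h8 ⟨u, hu⟩]; exact (hmem u hu).1
        · intro l hl
          rcases List.mem_append.1 hl with hl | hl
          · exact hlt.trans (h4 _ l hl)
          · rwa [List.eq_of_mem_replicate hl]
        · simpa using h7 ⟨u, hu⟩
        · simpa using h8 ⟨u, hu⟩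
        · rintro rfl
          exact absurd hs1 hsu
    · exact ⟨[], 0, fun h => absurd h hu⟩
  choose ls' i hls' using hdec
  exact ⟨ls', i, fun u hu => (hls' u hu).1, u₁.1, u₁.2, (hls' u₁.1 u₁.2).2 rfl⟩

variable [Fintype ι]

theorem bracket_sub_monomial_mem_spanAbove {r : V ⊗[k] V →ₗ[k] V ⊗[k] V}
    (hr : IsLeftTriangular X r) (u : List ι) :
    bracket X r u - monomial X u ∈ spanAbove X u := by
  obtain ⟨γ, hγ⟩ := hr
  exact wordSpan_mono (fun w hw => hw.2.stdGT hw.1) (bracket_sub_monomial_mem hγ u)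

/-- The words of `B_I` are normal. -/
theorem isNormal_of_mem_pbwWords [I.IsTwoSided] (hI : I ≠ ⊤)
    (hcoideal : (I.restrictScalars k).map (comul c) ≤ tensorIdeal I)
    (hc : IsLeftTriangularWith X c γ) (hγ : ∀ x y, γ x y ≠ 0)
    (hd : ∀ x y, d (X x ⊗ₜ[k] X y) = (γ y x)⁻¹ • (X y ⊗ₜ[k] X x)) {u : List ι}
    (hu : u ∈ pbwWords X I) : IsNormal X I u := by
  induction hn : u.length using Nat.strong_induction_on generalizing u with
  | _ n ih =>
  by_contra hnot
  have hne : u ≠ [] := by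
    rintro rfl
    exact hnot (isNormal_nil hI)
  have hd' := isLeftTriangularWith_of_diagonal (γ := fun x y => (γ y x)⁻¹) hd
  have hlead := bracket_sub_monomial_mem_spanAbove (X := X) ⟨_, hd'⟩
  -- A relation: a combination of commutators of words of `B_I` that lies in `I`.
  obtain ⟨α, hαI, hαu, hα⟩ : ∃ α : List ι →₀ k, Finsupp.linearCombination k (bracket X d) α ∈ I ∧
      α u = 1 ∧ ∀ v ∈ α.support, v ∈ pbwWords X I ∧ v.length ≤ n := by
    have h1 : bracket X d u ∈ Submodule.span k
        (bracket X d '' {v | IsNormal X I v ∧ StdGT v u}) ⊔ I.restrictScalars k := by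
      have hle := sup_le (spanAbove_le_span_normal (I := I) hlead u) le_sup_right
      have h2 := add_mem (hle (Submodule.mem_sup_left (hlead u))) (hle (not_not.1 hnot))
      simpa using h2
    obtain ⟨y, hy, z, hz, hyz⟩ := Submodule.mem_sup.1 h1
    obtain ⟨l, hl, rfl⟩ := (Finsupp.mem_span_image_iff_linearCombination k).1 hy
    have hlu : l u = 0 := by
      by_contra h
      exact not_stdGT_self u (hl (Finsupp.mem_support_iff.2 h)).2
    refine ⟨Finsupp.single u 1 - l, ?_, by simp [hlu], fun v hv => ?_⟩
    · rw [map_sub, Finsupp.linearCombination_single, one_smul, ← hyz, add_sub_cancel_left]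
      exact hz
    · by_cases hvu : v = u
      · subst hvu
        exact ⟨hu, hn.le⟩
      · have : v ∈ l.support := by
          rw [Finsupp.mem_support_iff] at hv ⊢
          intro h0
          apply hv
          simp [h0, Ne.symm hvu]
        have := hl this
        exact ⟨this.1.mem_pbwWords, this.2.length_le.trans hn.le⟩
  -- The words of maximal length in the relation, and their smallest Lyndon factor.
  set F := α.support.filter (fun v => v.length = n) with hFdef
  have huF : u ∈ F := by
    rw [hFdef, Finset.mem_filter, Finsupp.mem_support_iff, hαu]
    exact ⟨one_ne_zero, hn⟩
  have hpos : 0 < n := by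
    rw [← hn]
    exact List.length_pos_iff.2 hne
  obtain ⟨s, j, hs, hj, hheight, ls, i, hdec, w, hwF, hwj⟩ := exists_min_factor (X := X) (I := I)
    (F := F) ⟨u, huF⟩ (fun v hv => by
      rw [hFdef, Finset.mem_filter] at hv
      refine ⟨(hα v hv.1).1, ?_⟩
      rintro rfl
      exact hpos.ne hv.2)
  -- The smallest word in which `s` occurs with the maximal multiplicity `j`.
  obtain ⟨v₀, hv₀, hmin⟩ := (F.filter fun v => i v = j).exists_min_image id ⟨w, by simp [hwF, hwj]⟩
  rw [Finset.mem_filter] at hv₀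
  set p := (ls v₀).flatten with hp
  set S := wordPow s j with hS
  have hlenF : ∀ v ∈ F, v.length = n := fun v hv => (Finset.mem_filter.1 hv).2
  have hflat : ∀ v ∈ F, v = (ls v).flatten ++ wordPow s (i v) := fun v hv => by
    conv_lhs => rw [(hdec v hv).2.2.2.2.2]
    rw [List.flatten_append, wordPow]
  have hlenp : p.length + S.length = n := by
    rw [← hlenF v₀ hv₀.1]
    conv_rhs => rw [hflat v₀ hv₀.1, hv₀.2]
    rw [List.length_append]
  have hSpos : 0 < S.length := by
    rw [hS, length_wordPow]
    exact Nat.mul_pos hj hs.length_pos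
  have hpnormal : IsNormal X I p := ih p.length (by omega) (hdec v₀ hv₀.1).2.1 rfl
  have hSnormal : IsNormal X I S := isNormal_wordPow hheight
  obtain ⟨φ, hφS, hφ⟩ := Submodule.exists_le_ker_of_notMem hSnormal
  have hφI : ∀ a ∈ I, φ a = 0 := fun a ha => hφ (Submodule.mem_sup_right ha)
  have hφgt : ∀ a, StdGT a S → φ (monomial X a) = 0 :=
    fun a ha => hφ (Submodule.mem_sup_left (monomial_mem_spanAbove ha))
  -- `φ` vanishes on first tensor factors shorter than `S`, and longer ones leave second tensor
  -- factors shorter than `p`.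
  have hpair : ∀ (m : ℕ) (a b : List ι), m ≤ n → a.length + b.length = m →
      (m < n ∨ a.length ≠ S.length) →
      contractLeft φ (monomial X a ⊗ₜ[k] monomial X b) ∈ spanAbove X p := by
    intro m a b hm hab h
    rw [contractLeft_tmul]
    by_cases ha : a.length < S.length
    · rw [hφgt a (Or.inl ha), zero_smul]
      exact zero_mem _
    · refine Submodule.smul_mem _ _ (monomial_mem_spanAbove (Or.inl ?_))
      omega
  have hlenls : ∀ v ∈ F, (ls v).flatten.length + (wordPow s (i v)).length = n := fun v hv => by
    rw [← hlenF v hv]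
    conv_rhs => rw [hflat v hv]
    rw [List.length_append]
  have hgt : ∀ v ∈ F, i v = j → v ≠ v₀ → StdGT (ls v).flatten p := by
    intro v hv hvj hvne
    have hne' : (ls v).flatten ≠ p := fun h => hvne (by
      rw [hflat v hv, hflat v₀ hv₀.1, h, hvj, hv₀.2])
    refine (stdGT_or_of_ne hne').resolve_right fun h => ?_
    have h' := h.append [] S
    rw [List.nil_append, List.nil_append, hS] at h'
    nth_rewrite 1 [← hv₀.2] at h'
    nth_rewrite 1 [← hvj] at h'
    rw [hp, ← hflat v hv, ← hflat v₀ hv₀.1] at h'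
    rcases h' with h' | ⟨-, h'⟩
    · rw [hlenF v hv, hlenF v₀ hv₀.1] at h'
      exact lt_irrefl _ h'
    · exact absurd (hmin v (by simp [hv, hvj])) (not_le.2 h')
  have htermF : ∀ v ∈ F, contractLeft φ (comul c (bracket X d v)) -
      (wordCoeff γ (ls v).flatten (wordPow s (i v)) * φ (monomial X (wordPow s (i v)))) •
        monomial X (ls v).flatten ∈ spanAbove X p := by
    intro v hv
    obtain ⟨hls, -, hsls, hij, hlsr, -⟩ := hdec v hv
    have hbr : bracket X d v = bracket X d (ls v).flatten * bracket X d s ^ i v := by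
      conv_lhs => rw [(hdec v hv).2.2.2.2.2]
      rw [bracket_flatten X d hlsr, bracket_flatten X d hls, List.map_append, List.prod_append,
        List.map_replicate, List.prod_replicate]
    have hΔ := comul_bracket_mul_pow hc hγ hd hs hls hsls (i v)
    rw [← hbr, hlenls v hv] at hΔ
    have := map_tensorSpan (contractLeft φ) (N := spanAbove X p) (fun a b hab => ?_) hΔ
    · rwa [map_sub, map_smul, contractLeft_tmul, smul_smul] at this
    by_cases ha : a.length = S.length
    · rcases hab.1 with h | ⟨i', hi', rfl⟩ | ⟨rfl, h⟩
      · rw [contractLeft_tmul, hφgt a ((h.dominates_wordPow ha.le).stdGT ha), zero_smul]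
        exact zero_mem _
      · rw [hS, length_wordPow, length_wordPow] at ha
        have := Nat.eq_of_mul_eq_mul_right hs.length_pos ha
        omega
      · rw [hS, length_wordPow, length_wordPow] at ha
        have hvj := Nat.eq_of_mul_eq_mul_right hs.length_pos ha
        rw [contractLeft_tmul]
        refine Submodule.smul_mem _ _ (monomial_mem_spanAbove ?_)
        have hb : StdGT b (ls v).flatten := h.stdGT (by
          have := hab.2
          have := hlenls v hv
          omega)
        by_cases hvv : v = v₀
        · rwa [hvv] at hb
        · exact hb.trans (hgt v hv hvj hvv)
    · exact hpair n a b le_rfl hab.2 (Or.inr ha)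
  have hterm : ∀ v ∈ α.support, v ≠ v₀ →
      contractLeft φ (comul c (bracket X d v)) ∈ spanAbove X p := by
    intro v hv hvv
    by_cases hvn : v.length = n
    · have hvF : v ∈ F := Finset.mem_filter.2 ⟨hv, hvn⟩
      have h1 : (wordCoeff γ (ls v).flatten (wordPow s (i v)) *
          φ (monomial X (wordPow s (i v)))) • monomial X (ls v).flatten ∈ spanAbove X p := by
        rcases (hdec v hvF).2.2.2.1.eq_or_lt with hvj | hvj
        · exact Submodule.smul_mem _ _ (monomial_mem_spanAbove (hgt v hvF hvj hvv))
        · rw [hφgt (wordPow s (i v)) (Or.inl ?_), mul_zero, zero_smul]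
          · exact zero_mem _
          · rw [hS, length_wordPow, length_wordPow]
            exact Nat.mul_lt_mul_of_pos_right hvj hs.length_pos
      simpa using add_mem (htermF v hvF) h1
    · have hlt : v.length < n := lt_of_le_of_ne (hα v hv).2 hvn
      exact map_tensorSpan (contractLeft φ)
        (fun a b hab => hpair v.length a b hlt.le hab (Or.inl hlt))
        (comul_mem hc (bracket_mem_length hd' v))
  have hterm₀ : contractLeft φ (comul c (bracket X d v₀)) -
      (wordCoeff γ p S * φ (monomial X S)) • monomial X p ∈ spanAbove X p := by
    have := htermF v₀ hv₀.1
    rwa [hv₀.2] at this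
  have hmemI : contractLeft φ (comul c (Finsupp.linearCombination k (bracket X d) α)) ∈
      I.restrictScalars k :=
    contractLeft_mem hφI (hcoideal (Submodule.mem_map_of_mem hαI))
  have hv₀α : v₀ ∈ α.support := (Finset.mem_filter.1 hv₀.1).1
  have hsum : contractLeft φ (comul c (Finsupp.linearCombination k (bracket X d) α)) =
      α v₀ • contractLeft φ (comul c (bracket X d v₀)) +
        ∑ v ∈ α.support.erase v₀, α v • contractLeft φ (comul c (bracket X d v)) := by
    rw [Finsupp.linearCombination_apply, Finsupp.sum, map_sum, map_sum,
      Finset.add_sum_erase _ (fun v => α v • contractLeft φ (comul c (bracket X d v))) hv₀α]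
    simp only [map_smul]
  have hcoef : α v₀ * (wordCoeff γ p S * φ (monomial X S)) ≠ 0 :=
    mul_ne_zero (Finsupp.mem_support_iff.1 hv₀α) (mul_ne_zero (wordCoeff_ne_zero hγ p S) hφS)
  refine hpnormal ((Submodule.smul_mem_iff _ hcoef).1 ?_)
  have h1 : ∑ v ∈ α.support.erase v₀, α v • contractLeft φ (comul c (bracket X d v)) ∈
      spanAbove X p := Submodule.sum_mem _ fun v hv => by
    rw [Finset.mem_erase] at hv
    exact Submodule.smul_mem _ _ (hterm v hv.2 hv.1)
  have h2 := sub_mem (Submodule.mem_sup_right (S := spanAbove X p) hmemI)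
    (Submodule.mem_sup_left (add_mem h1 (Submodule.smul_mem _ (α v₀) hterm₀)))
  rw [hsum] at h2
  convert h2 using 1
  rw [smul_sub, smul_smul]
  abel

end Core

/-! ### The diagonal component -/

section Diagonal

variable {k : Type*} [Field k] {V : Type*} [AddCommGroup V] [Module k V]
  {ι : Type*} (X : Module.Basis ι k V)

/-- The diagonal map `x ⊗ y ↦ γ (x, y) • y ⊗ x`. -/
noncomputable def diagonalMap (γ : ι → ι → k) : V ⊗[k] V →ₗ[k] V ⊗[k] V :=
  (X.tensorProduct X).constr k fun p => γ p.1 p.2 • (X p.2 ⊗ₜ[k] X p.1)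

theorem diagonalMap_tmul (γ : ι → ι → k) (x y : ι) :
    diagonalMap X γ (X x ⊗ₜ[k] X y) = γ x y • (X y ⊗ₜ[k] X x) := by
  rw [← Module.Basis.tensorProduct_apply, diagonalMap, Module.Basis.constr_basis]

theorem braidEquation_diagonalMap (γ : ι → ι → k) : BraidEquation (diagonalMap X γ) := by
  unfold BraidEquation
  refine ((X.tensorProduct X).tensorProduct X).ext fun p => ?_
  obtain ⟨⟨x, y⟩, z⟩ := p
  simp only [Module.Basis.tensorProduct_apply, LinearMap.comp_apply, LinearEquiv.coe_coe,
    LinearMap.rTensor_tmul, LinearMap.lTensor_tmul, diagonalMap_tmul, TensorProduct.assoc_tmul,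
    TensorProduct.assoc_symm_tmul, map_smul, TensorProduct.tmul_smul, ← TensorProduct.smul_tmul',
    smul_smul]
  congr 1
  ring

/-- The map `x ⊗ y ↦ γ (x, y) • y ⊗ x` as an automorphism; its inverse is
`x ⊗ y ↦ γ (y, x)⁻¹ • y ⊗ x`. -/
noncomputable def diagonalEquiv (γ : ι → ι → k) (hγ : ∀ x y, γ x y ≠ 0) :
    V ⊗[k] V ≃ₗ[k] V ⊗[k] V :=
  LinearEquiv.ofLinearMap (diagonalMap X γ) (diagonalMap X fun x y => (γ y x)⁻¹)
    ((X.tensorProduct X).ext fun ⟨x, y⟩ => by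
      rw [Module.Basis.tensorProduct_apply, LinearMap.comp_apply, diagonalMap_tmul, map_smul,
        diagonalMap_tmul, smul_smul, inv_mul_cancel₀ (hγ _ _), one_smul, LinearMap.id_apply])
    ((X.tensorProduct X).ext fun ⟨x, y⟩ => by
      rw [Module.Basis.tensorProduct_apply, LinearMap.comp_apply, diagonalMap_tmul, map_smul,
        diagonalMap_tmul, smul_smul, mul_inv_cancel₀ (hγ _ _), one_smul, LinearMap.id_apply])

theorem diagonalEquiv_symm (γ : ι → ι → k) (hγ : ∀ x y, γ x y ≠ 0) :
    (diagonalEquiv X γ hγ).symm.toLinearMap = diagonalMap X fun x y => (γ y x)⁻¹ :=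
  rfl

variable {X} [LinearOrder ι] [Fintype ι]

/-- The diagonal coefficients of an injective left triangular map do not vanish: if
`γ (x₀, y₀) = 0`, the map sends the span of all `x ⊗ y` with `y ≥ y₀` into the span of all `z ⊗ t`
with `z ≥ y₀` except `y₀ ⊗ x₀`, whose dimension is smaller. -/
theorem IsLeftTriangularWith.ne_zero {r : V ⊗[k] V →ₗ[k] V ⊗[k] V} {γ : ι → ι → k}
    (hr : IsLeftTriangularWith X r γ) (hinj : r.ker = ⊥) (x₀ y₀ : ι) : γ x₀ y₀ ≠ 0 := by
  intro h0
  obtain ⟨v, hv⟩ := hr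
  classical
  let e : ι × ι → V ⊗[k] V := fun p => X p.1 ⊗ₜ[k] X p.2
  let A : Finset (ι × ι) := Finset.univ.filter fun p => y₀ ≤ p.1
  have hA0 : (y₀, x₀) ∈ A := by simp [A]
  let W : Submodule k (V ⊗[k] V) := Submodule.span k ((A.erase (y₀, x₀)).image e : Finset _)
  have he : ∀ z t, y₀ ≤ z → (z, t) ≠ (y₀, x₀) → X z ⊗ₜ[k] X t ∈ W := fun z t hz hne =>
    Submodule.subset_span (by
      rw [Finset.coe_image]
      exact ⟨(z, t), by simp [A, hz, hne], rfl⟩)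
  have hlin : LinearIndependent k fun p : A => r (e p.1.swap) := by
    have h1 : LinearIndependent k e := by
      have h := (X.tensorProduct X).linearIndependent
      have he : ⇑(X.tensorProduct X) = e :=
        funext fun ⟨x, y⟩ => Module.Basis.tensorProduct_apply X X x y
      rw [he] at h
      exact h
    exact (h1.comp (fun p : A => p.1.swap)
      (fun p q h => Subtype.ext (Prod.swap_injective h))).map' r hinj
  have hsub : Submodule.span k (Set.range fun p : A => r (e p.1.swap)) ≤ W := by
    refine Submodule.span_le.2 ?_
    rintro _ ⟨⟨⟨y, x⟩, hp⟩, rfl⟩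
    have hy : y₀ ≤ y := by simpa [A] using hp
    change r (X x ⊗ₜ[k] X y) ∈ W
    rw [hv]
    refine add_mem ?_ (Submodule.sum_mem _ fun z hz => ?_)
    · by_cases h : (y, x) = (y₀, x₀)
      · simp only [Prod.mk.injEq] at h
        rw [h.1, h.2, h0, zero_smul]
        exact zero_mem _
      · exact Submodule.smul_mem _ _ (he y x hy h)
    · have hyz : y < z := by simpa using hz
      rw [← X.sum_repr (v x y z), TensorProduct.tmul_sum]
      refine Submodule.sum_mem _ fun t _ => ?_
      rw [TensorProduct.tmul_smul]
      refine Submodule.smul_mem _ _ (he z t (hy.trans hyz.le) fun h => ?_)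
      simp only [Prod.mk.injEq] at h
      exact (hy.trans_lt hyz).ne h.1.symm
  have : Module.Finite k (V ⊗[k] V) := Module.Finite.of_basis (X.tensorProduct X)
  have h1 := Submodule.finrank_mono hsub
  rw [finrank_span_eq_card hlin, Fintype.card_coe] at h1
  have h2 : Module.finrank k W ≤ (A.erase (y₀, x₀)).card :=
    (finrank_span_finset_le_card _).trans Finset.card_image_le
  rw [Finset.card_erase_of_mem hA0] at h2
  have h3 := Finset.card_pos.2 ⟨_, hA0⟩
  omega

end Diagonal

end BraidedPBW

open BraidedPBW
theorem mainTheorem1 {k : Type*} [Field k] {V : Type*} [AddCommGroup V] [Module k V]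
    {ι : Type*} [LinearOrder ι] [Fintype ι] (X : Module.Basis ι k V)
    (c : V ⊗[k] V ≃ₗ[k] V ⊗[k] V)
    (hbraid : BraidEquation c.toLinearMap) (htri : IsLeftTriangular X c.toLinearMap)
    (I : Ideal (TensorAlgebra k V)) [I.IsTwoSided]
    (hI : IsBraidedBiideal c.toLinearMap I) (hproper : I ≠ ⊤) :
    -- commutators with respect to an arbitrary admissible endomorphism
    (∀ r : V ⊗[k] V →ₗ[k] V ⊗[k] V, IsAdmissible X r →
      LinearIndepOn k (bracket X r) (pbwWords X I) ∧
      IsCompl (Submodule.span k (bracket X r '' pbwWords X I)) (I.restrictScalars k) ∧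
      IsBasisOn k (fun u => Ideal.Quotient.mkₐ k I (bracket X r u)) (pbwWords X I) ∧
      pbwSet (fun u : hardWords X I => Ideal.Quotient.mkₐ k I (bracket X r u.1))
          (fun u => height X I u.1) =
        (fun u => Ideal.Quotient.mkₐ k I (bracket X r u)) '' pbwWords X I ∧
      IsPBWBasis k (fun u : hardWords X I => Ideal.Quotient.mkₐ k I (bracket X r u.1))
        (fun u => height X I u.1)) ∧
    -- commutators with respect to the inverse of the diagonal component of the braiding
    (∃ d : V ⊗[k] V ≃ₗ[k] V ⊗[k] V, IsDiagonalComponent X c.toLinearMap d.toLinearMap ∧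
      IsAdmissible X d.symm.toLinearMap ∧
      IsCompl (Submodule.span k (bracket X d.symm.toLinearMap '' pbwWords X I))
        (I.restrictScalars k)) ∧
    -- the words themselves
    (IsBasisOn k (fun u => Ideal.Quotient.mkₐ k I (monomial X u)) (pbwWords X I) ∧
      pbwSet (fun u : hardWords X I => Ideal.Quotient.mkₐ k I (monomial X u.1))
          (fun u => height X I u.1) =
        (fun u => Ideal.Quotient.mkₐ k I (monomial X u)) '' pbwWords X I ∧
      IsPBWBasis k (fun u : hardWords X I => Ideal.Quotient.mkₐ k I (monomial X u.1))
        (fun u => height X I u.1)) ∧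
    -- commutators with respect to the braiding
    (IsBasisOn k (fun u => Ideal.Quotient.mkₐ k I (bracket X c.toLinearMap u)) (pbwWords X I) ∧
      pbwSet (fun u : hardWords X I =>
            Ideal.Quotient.mkₐ k I (bracket X c.toLinearMap u.1))
          (fun u => height X I u.1) =
        (fun u => Ideal.Quotient.mkₐ k I (bracket X c.toLinearMap u)) '' pbwWords X I ∧
      IsPBWBasis k (fun u : hardWords X I =>
          Ideal.Quotient.mkₐ k I (bracket X c.toLinearMap u.1))
        (fun u => height X I u.1)) := by
  obtain ⟨γ, hγ⟩ := htri
  have hne : ∀ x y, γ x y ≠ 0 := hγ.ne_zero (LinearMap.ker_eq_bot.2 c.injective)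
  have hB : ∀ u, u ∈ pbwWords X I ↔ IsNormal X I u := fun u =>
    ⟨fun hu => isNormal_of_mem_pbwWords (d := diagonalMap X fun x y => (γ y x)⁻¹) hproper
      hI.comul_le hγ hne (diagonalMap_tmul X _) hu, fun hu => hu.mem_pbwWords⟩
  have hr : ∀ r : V ⊗[k] V →ₗ[k] V ⊗[k] V, IsLeftTriangular X r →
      LinearIndepOn k (bracket X r) (pbwWords X I) ∧
      IsCompl (Submodule.span k (bracket X r '' pbwWords X I)) (I.restrictScalars k) ∧
      IsBasisOn k (fun u => Ideal.Quotient.mkₐ k I (bracket X r u)) (pbwWords X I) ∧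
      pbwSet (fun u : hardWords X I => Ideal.Quotient.mkₐ k I (bracket X r u.1))
          (fun u => height X I u.1) =
        (fun u => Ideal.Quotient.mkₐ k I (bracket X r u)) '' pbwWords X I ∧
      IsPBWBasis k (fun u : hardWords X I => Ideal.Quotient.mkₐ k I (bracket X r u.1))
        (fun u => height X I u.1) := fun r hr => by
    have hb := bracket_sub_monomial_mem_spanAbove hr
    have hmul : ∀ ls, IsLyndonList ls → bracket X r ls.flatten = (ls.map (bracket X r)).prod :=
      fun ls hls => bracket_flatten X r hls
    obtain ⟨h1, h2, h3⟩ := isBasisOn_of_leading hb hB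
    exact ⟨h1, h2, h3, pbwSet_eq_image hmul, isPBWBasis_of_leading hb hmul hB⟩
  have htri' : IsLeftTriangular X (diagonalMap X fun x y => (γ y x)⁻¹) :=
    ⟨_, isLeftTriangularWith_of_diagonal (diagonalMap_tmul X fun x y => (γ y x)⁻¹)⟩
  refine ⟨fun r h => hr r h.2, ⟨diagonalEquiv X γ hne, ⟨γ, hγ, diagonalMap_tmul X γ⟩, ?_, ?_⟩, ?_,
    (hr c.toLinearMap ⟨γ, hγ⟩).2.2⟩
  · rw [diagonalEquiv_symm]
    exact ⟨braidEquation_diagonalMap X _, htri'⟩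
  · rw [diagonalEquiv_symm]
    exact (hr _ htri').2.1
  · have hb : ∀ u, monomial X u - monomial X u ∈ spanAbove X u := fun u => by
      rw [sub_self]
      exact zero_mem _
    have hmul : ∀ ls : List (List ι), IsLyndonList ls →
        monomial X ls.flatten = (ls.map (monomial X)).prod := fun ls hls => by
      induction ls with
      | nil => exact monomial_nil X
      | cons l ls ih => rw [List.flatten_cons, monomial_append, ih hls.of_cons, List.map_cons,
        List.prod_cons]
    exact ⟨(isBasisOn_of_leading hb hB).2.2, pbwSet_eq_image hmul,
      isPBWBasis_of_leading hb hmul hB⟩
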